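/- Conventions. For a metric space $(X,d)$ let $\overline X$ be its completion, $\partial X=\overline X\setminus X$ and $d_X(x)=\operatorname{dist}(x,\partial X)$. Curves are continuous maps on compact intervals, and $\ell$ denotes length. For $C\ge 1$, $X$ is called a *$C$-uniform domain* if $X$ is non-complete, $X$ is open in $\overline X$ (automatic if $X$ is locally compact), and any two distinct points $x,y\in X$ are joined by a curve $\gamma$ in $X$ with $\ell(\gamma)\le C\,d(x,y)$ and $\min\{\ell(\gamma_{x,z}),\ell(\gamma_{z,y})\}\le C\,d_X(z)$ for each point $z$ of $\gamma$. **Theorem 1.1.** Let $(\Omega,d)$ be an unbounded, locally compact $C_U$-uniform domain, and let $\varphi:(0,\infty)\to(0,\infty)$ be decreasing (not necessarily strictly) with $\varphi(t)=1$ for $0<t\le 1$, $\int_0^\infty\varphi(t)\,dt<\infty$, and $\varphi(t)\le C_\varphi\,\varphi(2t)$ for all $t>0$, where $C_\varphi\ge1$. For $x,y\in\Omega$ put $$d_\varphi(x,y)=\inf_\gamma\int_\gamma\varphi(d_\Omega)\,ds,$$ the infimum being over all rectifiable curves $\gamma$ in $\Omega$ from $x$ to $y$, parametrized by $d$-arc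 length. The identity map of $\Omega$ extends continuously to a map from $\Omega\cup\partial\Omega$ (with the metric $d$) to the completion of $\Omega$ with respect to $d_\varphi$; let $\Omega_\varphi$ be this completion with the image of $\partial\Omega$ removed, equipped with the metric $d_\varphi$. Then: 1. $\Omega_\varphi=\Omega\cup\{\infty\}$ for a single point $\infty\notin\Omega$, and the identity map $I:\Omega\to\Omega_\varphi\setminus\{\infty\}$ is a homeomorphism. 2. $\Omega_\varphi$ is bounded, and it is an $A$-uniform domain with a constant $A$ that depends only on $C_\varphi$ and $C_U$. 3. $\partial\Omega_\varphi=\partial\Omega$: there is a homeomorphism $e:\partial\Omega\to\partial\Omega_\varphi$ such that, for $\zeta\in\partial\Omega$, a sequence in $\Omega$ converges to $\zeta$ with respect to $d$ if and only if it converges to $e(\zeta)$ with respect to $d_\varphi$. 4. $I$ is locally bi-Lipschitz: each point of $\Omega$ has a neighbourhood on which $I$ is bi-Lipschitz. It is uniformly so near $\partial\Omega$: there are $r>0$ and $K\ge1$ such that for every $\zeta\in\partial\Omega$ the map $I$ is $K$-bi-Lipschitz on $\{x\in\Omega: d(x,\zeta)<r\}$. 5. If $\Omega$ is a length space, then $I$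 is a local isometry near $\partial\Omega$: there is $r>0$ such that for every $\zeta\in\partial\Omega$, $d_\varphi(x,y)=d(x,y)$ for all $x,y\in\Omega$ with $d(x,\zeta)<r$ and $d(y,\zeta)<r$. -/

import Mathlib

open Set Filter Topology MeasureTheory
open scoped ENNReal

namespace DampedDomain

universe u

/-! ### Boundary, curves, uniform domains -/

/-- The boundary of a metric space: the points of its completion that are not in the space. -/
def boundary (X : Type u) [MetricSpace X] : Set (UniformSpace.Completion X) :=
  (range ((↑) : X → UniformSpace.Completion X))ᶜ

/-- The distance from a point of `X` to the boundary of `X`, measured in the completion. -/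
noncomputable def bdist {X : Type u} [MetricSpace X] (x : X) : ℝ :=
  Metric.infDist (x : UniformSpace.Completion X) (boundary X)

/-- `γ : [0,1] → X` is a (continuous) curve from `x` to `y`. -/
structure IsCurve {X : Type u} [MetricSpace X] (γ : ℝ → X) (x y : X) : Prop where
  continuousOn : ContinuousOn γ (Icc 0 1)
  source : γ 0 = x
  target : γ 1 = y

/-- `γ` is a `C`-uniform curve from `x` to `y`.
The length of a curve is its total variation `eVariationOn`. -/
structure IsUniformCurve {X : Type u} [MetricSpace X] (C : ℝ) (γ : ℝ → X) (x y : X) : Prop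
    extends IsCurve γ x y where
  length_le : eVariationOn γ (Icc 0 1) ≤ ENNReal.ofReal (C * dist x y)
  min_length_le : ∀ t ∈ Icc (0 : ℝ) 1,
    min (eVariationOn γ (Icc 0 t)) (eVariationOn γ (Icc t 1)) ≤ ENNReal.ofReal (C * bdist (γ t))

/-- `X` is a uniform domain in its completion, with uniformity constant `C`: it is non-complete, it
is open in its completion (which is automatic when `X` is locally compact), and any two distinct
points are the end points of a `C`-uniform curve. -/
structure IsUniformDomain (C : ℝ) (X : Type u) [MetricSpace X] : Prop where
  one_le : 1 ≤ C
  not_complete : ¬ CompleteSpace X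
  isOpen_range : IsOpen (range ((↑) : X → UniformSpace.Completion X))
  exists_curve : ∀ x y : X, x ≠ y → ∃ γ : ℝ → X, IsUniformCurve C γ x y

/-- Any two points are joined by a curve of finite length. -/
def RectifiablyConnected (X : Type u) [MetricSpace X] : Prop :=
  ∀ x y : X, ∃ γ : ℝ → X, IsCurve γ x y ∧ eVariationOn γ (Icc 0 1) ≠ ⊤

theorem IsUniformDomain.rectifiablyConnected {C : ℝ} {X : Type u} [MetricSpace X]
    (h : IsUniformDomain C X) : RectifiablyConnected X := by
  intro x y
  by_cases hxy : x = y
  · subst hxy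
    refine ⟨fun _ => x, ⟨continuousOn_const, rfl, rfl⟩, ?_⟩
    rw [eVariationOn.constant_on]
    · exact ENNReal.zero_ne_top
    · rintro _ ⟨_, _, rfl⟩ _ ⟨_, _, rfl⟩
      rfl
  · obtain ⟨γ, hγ⟩ := h.exists_curve x y hxy
    exact ⟨γ, hγ.toIsCurve, ne_top_of_le_ne_top ENNReal.ofReal_ne_top hγ.length_le⟩

/-- A length space: the distance of two points is the infimum of the lengths of the curves that
join them. -/
def IsLengthSpace (X : Type u) [MetricSpace X] : Prop :=
  ∀ x y : X, edist x y = ⨅ (γ : ℝ → X) (_ : IsCurve γ x y), eVariationOn γ (Icc 0 1)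

/-! ### Weights and the conformally deformed metric -/

/-- The weights `φ : (0,∞) → (0,∞)`; only the values of `φ` on `(0,∞)` matter. -/
structure IsWeight (C : ℝ) (φ : ℝ → ℝ) : Prop where
  one_le : 1 ≤ C
  pos : ∀ t, 0 < t → 0 < φ t
  antitone : AntitoneOn φ (Ioi 0)
  eq_one : ∀ t, 0 < t → t ≤ 1 → φ t = 1
  integrable : IntegrableOn φ (Ioi 0)
  doubling : ∀ t, 0 < t → φ t ≤ C * φ (2 * t)

/-- `γ : [0,L] → X` is a rectifiable curve from `x` to `y`, of length `L`, parametrized by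
arc length. -/
structure IsArcLengthCurve {X : Type u} [MetricSpace X] (L : ℝ) (γ : ℝ → X) (x y : X) : Prop where
  nonneg : 0 ≤ L
  unitSpeed : HasUnitSpeedOn γ (Icc 0 L)
  source : γ 0 = x
  target : γ L = y

/-- The path integral `∫_γ φ(dist(·, ∂X)) ds` of a curve `γ : [0,L] → X` parametrized by
arc length. -/
noncomputable def weightedLength {X : Type u} [MetricSpace X] (φ : ℝ → ℝ) (L : ℝ) (γ : ℝ → X) :
    ℝ≥0∞ :=
  ∫⁻ s in Icc 0 L, ENNReal.ofReal (φ (bdist (γ s)))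

/-- `d_φ(x,y)`: the infimum of `∫_γ φ(dist(·, ∂X)) ds` over all rectifiable curves `γ` in `X` from
`x` to `y`. -/
noncomputable def dampedEDist {X : Type u} [MetricSpace X] (φ : ℝ → ℝ) (x y : X) : ℝ≥0∞ :=
  ⨅ (L : ℝ) (γ : ℝ → X) (_ : IsArcLengthCurve L γ x y), weightedLength φ L γ

theorem dampedEDist_le {X : Type u} [MetricSpace X] (φ : ℝ → ℝ) {x y : X} {L : ℝ} {γ : ℝ → X}
    (h : IsArcLengthCurve L γ x y) : dampedEDist φ x y ≤ weightedLength φ L γ :=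
  iInf_le_of_le L (iInf_le_of_le γ (iInf_le _ h))

theorem dampedEDist_self {X : Type u} [MetricSpace X] (φ : ℝ → ℝ) (x : X) :
    dampedEDist φ x x = 0 := by
  have h : IsArcLengthCurve 0 (fun _ => x) x x :=
    ⟨le_rfl, hasConstantSpeedOnWith_of_subsingleton _ (by simp) _, rfl, rfl⟩
  refine le_antisymm ((dampedEDist_le φ h).trans ?_) (zero_le)
  simp [weightedLength]

theorem dampedEDist_comm_le {X : Type u} [MetricSpace X] (φ : ℝ → ℝ) (x y : X) :
    dampedEDist φ x y ≤ dampedEDist φ y x := by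
  refine le_iInf fun L => le_iInf fun γ => le_iInf fun h => ?_
  have h' : IsArcLengthCurve L (fun s => γ (L - s)) x y := by
    refine ⟨h.nonneg, ?_, by simpa using h.target, by simpa using h.source⟩
    intro a ha b hb
    rcases le_total a b with hab | hab
    · have e := h.unitSpeed
        (⟨by linarith [hb.2], by linarith [hb.1]⟩ : L - b ∈ Icc 0 L)
        (⟨by linarith [ha.2], by linarith [ha.1]⟩ : L - a ∈ Icc 0 L)
      have i1 : Icc 0 L ∩ Icc (L - b) (L - a) = Icc (L - b) (L - a) :=
        inter_eq_right.2 (Icc_subset_Icc (by linarith [hb.2]) (by linarith [ha.1]))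
      have i2 : Icc 0 L ∩ Icc a b = Icc a b :=
        inter_eq_right.2 (Icc_subset_Icc ha.1 hb.2)
      have i3 : (fun s => L - s) '' Icc a b = Icc (L - b) (L - a) := by simp
      rw [i1] at e
      rw [i2]
      have := eVariationOn.comp_eq_of_antitoneOn γ (t := Icc a b) (fun s => L - s)
        (fun s _ t _ hst => by simp only; linarith)
      rw [i3, e] at this
      refine Eq.trans this ?_
      congr 1
      simp
    · rw [eVariationOn.subsingleton, ENNReal.ofReal_of_nonpos]
      · simpa using hab
      · rintro z ⟨_, hz⟩ w ⟨_, hw⟩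
        exact le_antisymm (by linarith [hz.2, hw.1]) (by linarith [hw.2, hz.1])
  refine (dampedEDist_le φ h').trans (le_of_eq ?_)
  unfold weightedLength
  rw [← lintegral_indicator measurableSet_Icc, ← lintegral_indicator measurableSet_Icc,
    ← lintegral_sub_left_eq_self ((Icc 0 L).indicator
      fun s => ENNReal.ofReal (φ (bdist (γ s)))) L]
  refine lintegral_congr fun s => ?_
  by_cases hs : s ∈ Icc 0 L
  · rw [indicator_of_mem hs, indicator_of_mem]
    exact ⟨by linarith [hs.2], by linarith [hs.1]⟩
  · rw [indicator_of_notMem hs, indicator_of_notMem]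
    exact fun h => hs ⟨by linarith [h.2], by linarith [h.1]⟩

theorem dampedEDist_triangle {X : Type u} [MetricSpace X] (φ : ℝ → ℝ) (x y z : X) :
    dampedEDist φ x z ≤ dampedEDist φ x y + dampedEDist φ y z := by
  unfold dampedEDist
  simp only [ENNReal.iInf_add, ENNReal.add_iInf]
  refine le_iInf fun L => le_iInf fun γ => le_iInf fun h => le_iInf fun M => le_iInf fun δ =>
    le_iInf fun k => ?_
  set c : ℝ → X := fun s => if s ≤ M then δ s else γ (s - M) with hc
  have c1 : ∀ s, s ≤ M → c s = δ s := fun s hs => if_pos hs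
  have c2 : ∀ s, M ≤ s → c s = γ (s - M) := by
    intro s hs
    rcases hs.eq_or_lt with rfl | hs
    · rw [c1 M le_rfl, sub_self]
      exact k.target.trans h.source.symm
    · exact if_neg (not_le.2 hs)
  have hcurve : IsArcLengthCurve (M + L) c x z := by
    refine ⟨add_nonneg k.nonneg h.nonneg, ?_, (c1 0 k.nonneg).trans k.source, ?_⟩
    · refine HasUnitSpeedOn.Icc_Icc (y := M) ?_ ?_
      · intro a ha b hb
        rw [← k.unitSpeed ha hb]
        exact eVariationOn.congr fun s hs => c1 s hs.1.2
      · intro a ha b hb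
        have e := h.unitSpeed
          (⟨by linarith [ha.1], by linarith [ha.2]⟩ : a - M ∈ Icc 0 L)
          (⟨by linarith [hb.1], by linarith [hb.2]⟩ : b - M ∈ Icc 0 L)
        have i : (fun s => s - M) '' (Icc M (M + L) ∩ Icc a b)
            = Icc 0 L ∩ Icc (a - M) (b - M) := by
          rw [Icc_inter_Icc, Icc_inter_Icc, image_sub_const_Icc]
          congr 1
          · rw [max_sub_sub_right M a M |>.symm, sub_self]
          · rw [min_sub_sub_right (M + L) b M |>.symm, add_sub_cancel_left]
        rw [eVariationOn.congr (g := γ ∘ fun s => s - M) fun s hs => c2 s hs.1.1,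
          eVariationOn.comp_eq_of_monotoneOn γ (fun s => s - M)
            (fun s _ t _ hst => by simp only; linarith), i, e]
        congr 2
        ring
    · rw [c2 _ (by linarith [h.nonneg]), add_sub_cancel_left]
      exact h.target
  refine (dampedEDist_le φ hcurve).trans ?_
  unfold weightedLength
  rw [← Icc_union_Icc_eq_Icc k.nonneg (by linarith [h.nonneg] : M ≤ M + L)]
  refine (lintegral_union_le _ _ _).trans (add_le_add ?_ ?_)
  · refine (setLIntegral_congr_fun measurableSet_Icc fun s hs => ?_).le
    simp only [c1 s hs.2]
  · rw [← lintegral_indicator measurableSet_Icc, ← lintegral_indicator measurableSet_Icc,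
      ← lintegral_sub_right_eq_self ((Icc 0 L).indicator
        fun s => ENNReal.ofReal (φ (bdist (γ s)))) M]
    refine (lintegral_congr fun s => ?_).le
    by_cases hs : s ∈ Icc M (M + L)
    · rw [indicator_of_mem hs, indicator_of_mem, c2 s hs.1]
      exact ⟨by linarith [hs.1], by linarith [hs.2]⟩
    · rw [indicator_of_notMem hs, indicator_of_notMem]
      exact fun h => hs ⟨by linarith [h.1], by linarith [h.2]⟩

/-- A rectifiable curve can be parametrized by arc length. -/
theorem exists_isArcLengthCurve {X : Type u} [MetricSpace X] {γ : ℝ → X} {x y : X}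
    (h : IsCurve γ x y) (hfin : eVariationOn γ (Icc 0 1) ≠ ⊤) :
    ∃ (L : ℝ) (δ : ℝ → X), IsArcLengthCurve L δ x y := by
  set s : Set ℝ := Icc 0 1 with hs
  have hb : BoundedVariationOn γ s := hfin
  have hl : LocallyBoundedVariationOn γ s := hb.locallyBoundedVariationOn
  have h0 : (0 : ℝ) ∈ s := ⟨le_rfl, zero_le_one⟩
  have h1 : (1 : ℝ) ∈ s := ⟨zero_le_one, le_rfl⟩
  set V : ℝ → ℝ := variationOnFromTo γ s 0 with hV
  have hV0 : V 0 = 0 := variationOnFromTo.self γ s 0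
  have hmono : MonotoneOn V s := variationOnFromTo.monotoneOn hl h0
  have hcont : ContinuousOn V s := by
    intro t ht
    have hc : ContinuousWithinAt γ s t := h.continuousOn t ht
    have l1 := hb.tendsto_eVariationOn_Icc_zero_left (hc.mono inter_subset_left)
    have l2 := hb.tendsto_eVariationOn_Icc_zero_right t (hc.mono inter_subset_left)
    have l1' := (ENNReal.tendsto_toReal ENNReal.zero_ne_top).comp l1
    have l2' := (ENNReal.tendsto_toReal ENNReal.zero_ne_top).comp l2
    have l3 := l1'.add l2'
    rw [ENNReal.toReal_zero, add_zero] at l3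
    refine tendsto_iff_dist_tendsto_zero.2 (squeeze_zero' ?_ ?_ l3)
    · exact Eventually.of_forall fun _ => dist_nonneg
    · filter_upwards [self_mem_nhdsWithin] with r hr
      have e : V r - V t = variationOnFromTo γ s t r := by
        rw [sub_eq_iff_eq_add', hV]
        exact (variationOnFromTo.add hl h0 ht hr).symm
      rw [Real.dist_eq, e]
      rcases le_total t r with htr | hrt
      · rw [variationOnFromTo.eq_of_le γ s htr, abs_of_nonneg ENNReal.toReal_nonneg]
        exact le_add_of_nonneg_left ENNReal.toReal_nonneg
      · rw [variationOnFromTo.eq_of_ge γ s hrt, abs_neg, abs_of_nonneg ENNReal.toReal_nonneg]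
        exact le_add_of_nonneg_right ENNReal.toReal_nonneg
  have himage : V '' s = Icc 0 (V 1) := by
    refine Subset.antisymm ?_ ?_
    · rintro _ ⟨t, ht, rfl⟩
      exact ⟨hV0 ▸ hmono h0 ht ht.1, hmono ht h1 ht.2⟩
    · have := intermediate_value_Icc zero_le_one hcont
      rwa [hV0] at this
  have hspeed := has_unit_speed_naturalParameterization γ hl h0
  refine ⟨V 1, naturalParameterization γ s 0, hV0 ▸ hmono h0 h1 zero_le_one, ?_, ?_, ?_⟩
  · rw [← himage]
    exact hspeed
  · have := edist_naturalParameterization_eq_zero hl h0 h0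
    rw [variationOnFromTo.self] at this
    exact (edist_eq_zero.1 this).trans h.source
  · exact (edist_eq_zero.1 (edist_naturalParameterization_eq_zero hl h0 h1)).trans h.target

theorem dampedEDist_ne_top {X : Type u} [MetricSpace X] (hX : RectifiablyConnected X) {C : ℝ}
    {φ : ℝ → ℝ} (hφ : IsWeight C φ) (x y : X) : dampedEDist φ x y ≠ ⊤ := by
  obtain ⟨γ, hγ, hfin⟩ := hX x y
  obtain ⟨L, δ, hδ⟩ := exists_isArcLengthCurve hγ hfin
  refine ne_top_of_le_ne_top ?_ (dampedEDist_le φ hδ)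
  have hle : ∀ t, 0 ≤ t → φ t ≤ max 1 (φ 0) := by
    intro t ht
    rcases ht.eq_or_lt with rfl | ht
    · exact le_max_right _ _
    · refine le_max_of_le_left ?_
      rcases le_total t 1 with h1 | h1
      · exact (hφ.eq_one t ht h1).le
      · rw [← hφ.eq_one 1 one_pos le_rfl]
        exact hφ.antitone (mem_Ioi.2 one_pos) ht h1
  have : weightedLength φ L δ ≤ ∫⁻ _ in Icc 0 L, ENNReal.ofReal (max 1 (φ 0)) :=
    lintegral_mono fun s => ENNReal.ofReal_le_ofReal (hle _ Metric.infDist_nonneg)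
  refine ne_top_of_le_ne_top ?_ this
  rw [setLIntegral_const, Real.volume_Icc]
  exact ENNReal.mul_ne_top ENNReal.ofReal_ne_top ENNReal.ofReal_ne_top

theorem dampedDist_self {X : Type u} [MetricSpace X] (φ : ℝ → ℝ) (x : X) :
    (dampedEDist φ x x).toReal = 0 := by
  rw [dampedEDist_self, ENNReal.toReal_zero]

theorem dampedDist_comm {X : Type u} [MetricSpace X] (φ : ℝ → ℝ) (x y : X) :
    (dampedEDist φ x y).toReal = (dampedEDist φ y x).toReal := by
  rw [le_antisymm (dampedEDist_comm_le φ x y) (dampedEDist_comm_le φ y x)]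

theorem dampedDist_triangle {X : Type u} [MetricSpace X] (hX : RectifiablyConnected X) {C : ℝ}
    {φ : ℝ → ℝ} (hφ : IsWeight C φ) (x y z : X) :
    (dampedEDist φ x z).toReal ≤ (dampedEDist φ x y).toReal + (dampedEDist φ y z).toReal := by
  have h1 := dampedEDist_ne_top hX hφ x y
  have h2 := dampedEDist_ne_top hX hφ y z
  rw [← ENNReal.toReal_add h1 h2]
  exact ENNReal.toReal_mono (ENNReal.add_ne_top.2 ⟨h1, h2⟩) (dampedEDist_triangle φ x y z)

/-- The set `X`, to be equipped with the metric `d_φ` in place of its own metric. -/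
def Damped {X : Type u} [MetricSpace X] {C : ℝ} {φ : ℝ → ℝ} (_ : RectifiablyConnected X)
    (_ : IsWeight C φ) : Type u := X

section Damped

variable {X : Type u} [MetricSpace X] {C : ℝ} {φ : ℝ → ℝ}
variable (hX : RectifiablyConnected X) (hφ : IsWeight C φ)

/-- The metric `d_φ`. (That `d_φ` separates points is not needed here: the completion below is
the separated one.) -/
noncomputable instance : PseudoMetricSpace (Damped hX hφ) where
  dist := (fun x y => (dampedEDist φ x y).toReal : X → X → ℝ)
  dist_self := dampedDist_self (X := X) φ
  dist_comm := dampedDist_comm (X := X) φ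
  dist_triangle := dampedDist_triangle hX hφ

/-- The identity map from `(X, d)` to `(X, d_φ)`. -/
def toDamped : X → Damped hX hφ := id

/-- The completion of `X` with respect to `d_φ`. -/
abbrev DampedCompletion : Type u := UniformSpace.Completion (Damped hX hφ)

/-- The extension to `X ∪ ∂X` (the completion of `X` for `d`) of the identity map of `X`, by
continuity, with values in the completion of `X` for `d_φ`. It is through this map that the metric
`d_φ` extends to `X ∪ ∂X`. -/
noncomputable def closureMap : UniformSpace.Completion X → DampedCompletion hX hφ :=
  UniformSpace.Completion.map (toDamped hX hφ)

/-- The space `X_φ`: the completion for `d_φ`, with the points of `∂X` removed. As a subset of the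
completion it is a metric space for `d_φ`. -/
def dampedDomain : Set (DampedCompletion hX hφ) :=
  (closureMap hX hφ '' boundary X)ᶜ

end Damped

/-! ### Bi-Lipschitz maps and isometries -/

/-- `f` is bi-Lipschitz on the set `s`, with constant `K`. -/
def BiLipschitzOn {X Y : Type u} [MetricSpace X] [MetricSpace Y] (K : ℝ) (f : X → Y) (s : Set X) :
    Prop :=
  ∀ x ∈ s, ∀ y ∈ s, dist x y ≤ K * dist (f x) (f y) ∧ dist (f x) (f y) ≤ K * dist x y

/-- Every point has a neighbourhood on which `f` is bi-Lipschitz. -/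
def LocallyBiLipschitz {X Y : Type u} [MetricSpace X] [MetricSpace Y] (f : X → Y) : Prop :=
  ∀ x, ∃ U ∈ 𝓝 x, ∃ K : ℝ, 1 ≤ K ∧ BiLipschitzOn K f U

/-- The points of `X` at distance less than `r` from the boundary point `ζ`. -/
def boundaryBall {X : Type u} [MetricSpace X] (ζ : boundary X) (r : ℝ) : Set X :=
  {x | dist (x : UniformSpace.Completion X) ζ < r}

/-- `f` is bi-Lipschitz near every boundary point, with a radius and a constant that do not depend
on the boundary point. -/
def UniformlyLocallyBiLipschitzNearBoundary {X Y : Type u} [MetricSpace X] [MetricSpace Y]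
    (f : X → Y) : Prop :=
  ∃ r : ℝ, 0 < r ∧ ∃ K : ℝ, 1 ≤ K ∧ ∀ ζ : boundary X, BiLipschitzOn K f (boundaryBall ζ r)

/-- `f` preserves distances near every boundary point, with a radius that does not depend on the
boundary point. -/
def LocallyIsometricNearBoundary {X Y : Type u} [MetricSpace X] [MetricSpace Y]
    (f : X → Y) : Prop :=
  ∃ r : ℝ, 0 < r ∧ ∀ ζ : boundary X, ∀ x ∈ boundaryBall ζ r, ∀ y ∈ boundaryBall ζ r,
    dist (f x) (f y) = dist x y

end DampedDomain

namespace DampedDomain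

universe u

/-! ### Weights and their primitives -/

/-! Write Φ for `primitive φ`. Increments of Φ control d_φ from both sides. From below: `bdist` is
1-Lipschitz, so after arc length s a curve from x has boundary distance at most `bdist x + s`. As φ
decreases, the weighted length of a curve to y is at least Φ(bdist x + d(x,y)) - Φ(bdist x)
(`ofReal_primitive_sub_le_dampedEDist`). From above: along the first half of a uniform curve the
boundary distance is at least a constant multiple of `bdist x + s`, so doubling bounds the weighted
length by a constant times an increment of the same kind (`IsCigarFrom.lintegral_le`). Φ is concave,
so the two increments are comparable, and a uniform curve for d is short for d_φ as well.

Φ is bounded, so points far from the boundary are close to one another for d_φ and converge to a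
single point ∞. At bounded boundary distance d_φ controls d locally, so a point of the damped
completion is either ∞ or comes from the completion for d (`eq_infinity_or_mem_range`).

The function Φ ∘ bdist is 1-Lipschitz for d_φ. Its extension `height` to the completion vanishes
exactly on the image of ∂Ω, so it bounds the distance to the new boundary from below
(`height_le_bdist`). The initial piece of a cigar has weighted length at most a constant times
Φ(bdist) at the end of that piece (`IsCigarFrom.lintegral_le_primitive`); together these give the
second condition on uniform curves. Points are joined to ∞ by rays (`exists_ray`), built from pieces
of uniform curves, each of which at least doubles the boundary distance.

Near ∂Ω the weight is 1, so the lower bound becomes d itself; in a length space φ ≤ 1 gives the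
matching upper bound. -/

/-- The primitive `t ↦ ∫_0^t φ` of a weight. -/
noncomputable def primitive (φ : ℝ → ℝ) (t : ℝ) : ℝ := ∫ s in (0 : ℝ)..t, φ s

theorem primitive_zero (φ : ℝ → ℝ) : primitive φ 0 = 0 := intervalIntegral.integral_same

namespace IsWeight

variable {C : ℝ} {φ : ℝ → ℝ}

theorem le_one (hφ : IsWeight C φ) {t : ℝ} (ht : 0 < t) : φ t ≤ 1 := by
  rcases le_total t 1 with h1 | h1
  · exact (hφ.eq_one t ht h1).le
  · rw [← hφ.eq_one 1 one_pos le_rfl]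
    exact hφ.antitone (mem_Ioi.2 one_pos) ht h1

theorem le_pow_mul (hφ : IsWeight C φ) (k : ℕ) {t : ℝ} (ht : 0 < t) :
    φ t ≤ C ^ k * φ (2 ^ k * t) := by
  induction k with
  | zero => simp
  | succ k ih =>
    refine ih.trans ?_
    have h := hφ.doubling (2 ^ k * t) (by positivity)
    have hC : 0 ≤ C ^ k := pow_nonneg (zero_le_one.trans hφ.one_le) k
    calc C ^ k * φ (2 ^ k * t) ≤ C ^ k * (C * φ (2 * (2 ^ k * t))) := by gcongr
      _ = C ^ (k + 1) * φ (2 ^ (k + 1) * t) := by ring_nf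

theorem le_pow_mul_of_le (hφ : IsWeight C φ) {k : ℕ} {s t : ℝ} (hs : 0 < s) (ht : 0 < t)
    (h : t ≤ 2 ^ k * s) : φ s ≤ C ^ k * φ t :=
  (hφ.le_pow_mul k hs).trans <| mul_le_mul_of_nonneg_left
    (hφ.antitone (mem_Ioi.2 ht) (mem_Ioi.2 (by positivity)) h)
    (pow_nonneg (zero_le_one.trans hφ.one_le) k)

theorem intervalIntegrable (hφ : IsWeight C φ) {a b : ℝ} (ha : 0 ≤ a) (hb : 0 ≤ b) :
    IntervalIntegrable φ volume a b := by
  rw [intervalIntegrable_iff]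
  exact hφ.integrable.mono_set fun s hs => (le_min ha hb).trans_lt hs.1

theorem primitive_sub (hφ : IsWeight C φ) {a b : ℝ} (ha : 0 ≤ a) (hb : 0 ≤ b) :
    primitive φ b - primitive φ a = ∫ s in a..b, φ s :=
  intervalIntegral.integral_interval_sub_left (hφ.intervalIntegrable le_rfl hb)
    (hφ.intervalIntegrable le_rfl ha)

theorem primitive_lt (hφ : IsWeight C φ) {a b : ℝ} (ha : 0 ≤ a) (hab : a < b) :
    primitive φ a < primitive φ b := by
  rw [← sub_pos, hφ.primitive_sub ha (ha.trans hab.le)]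
  exact intervalIntegral.intervalIntegral_pos_of_pos_on
    (hφ.intervalIntegrable ha (ha.trans hab.le)) (fun s hs => hφ.pos s (ha.trans_lt hs.1)) hab

theorem primitive_le (hφ : IsWeight C φ) {a b : ℝ} (ha : 0 ≤ a) (hab : a ≤ b) :
    primitive φ a ≤ primitive φ b := by
  rcases hab.eq_or_lt with rfl | hab
  · exact le_rfl
  · exact (hφ.primitive_lt ha hab).le

theorem primitive_nonneg (hφ : IsWeight C φ) {a : ℝ} (ha : 0 ≤ a) : 0 ≤ primitive φ a :=
  primitive_zero φ ▸ hφ.primitive_le le_rfl ha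

theorem primitive_pos (hφ : IsWeight C φ) {a : ℝ} (ha : 0 < a) : 0 < primitive φ a :=
  primitive_zero φ ▸ hφ.primitive_lt le_rfl ha

theorem tendsto_primitive (hφ : IsWeight C φ) :
    Tendsto (primitive φ) atTop (𝓝 (∫ s in Ioi 0, φ s)) :=
  intervalIntegral_tendsto_integral_Ioi 0 hφ.integrable tendsto_id

theorem primitive_le_integral (hφ : IsWeight C φ) {a : ℝ} (ha : 0 ≤ a) :
    primitive φ a ≤ ∫ s in Ioi 0, φ s :=
  ge_of_tendsto hφ.tendsto_primitive <|
    (eventually_ge_atTop a).mono fun _ h => hφ.primitive_le ha h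

theorem primitive_lt_integral (hφ : IsWeight C φ) {a : ℝ} (ha : 0 ≤ a) :
    primitive φ a < ∫ s in Ioi 0, φ s :=
  (hφ.primitive_lt ha (lt_add_one a)).trans_le (hφ.primitive_le_integral (by linarith))

/-- On `Ioc` the argument of φ is positive, as pointwise comparisons require: the value of φ at 0 is
arbitrary. -/
theorem lintegral_add_left (hφ : IsWeight C φ) {t D : ℝ} (ht : 0 ≤ t) (hD : 0 ≤ D) :
    ∫⁻ s in Ioc 0 D, ENNReal.ofReal (φ (t + s))
      = ENNReal.ofReal (primitive φ (t + D) - primitive φ t) := by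
  have hi : IntervalIntegrable (fun s => φ (t + s)) volume 0 D := by
    have := (hφ.intervalIntegrable ht (add_nonneg ht hD)).comp_add_left t
    simpa using this
  rw [hφ.primitive_sub ht (add_nonneg ht hD)]
  have := intervalIntegral.integral_comp_add_left (a := 0) (b := D) φ t
  rw [add_zero] at this
  rw [← this, intervalIntegral.integral_of_le hD, ofReal_integral_eq_lintegral_ofReal
    ((intervalIntegrable_iff_integrableOn_Ioc_of_le hD).1 hi)]
  filter_upwards [ae_restrict_mem measurableSet_Ioc] with s hs
  exact (hφ.pos _ (by linarith [hs.1])).le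

theorem lintegral_div (hφ : IsWeight C φ) {Q a : ℝ} (hQ : 0 < Q) (ha : 0 ≤ a) :
    ∫⁻ s in Ioc 0 a, ENNReal.ofReal (φ (s / Q)) = ENNReal.ofReal (Q * primitive φ (a / Q)) := by
  have hi : IntervalIntegrable (fun s => φ (s / Q)) volume 0 a := by
    have := (hφ.intervalIntegrable le_rfl (div_nonneg ha hQ.le)).comp_mul_right (c := Q⁻¹)
    simpa [div_eq_mul_inv, hQ.ne'] using this
  have := intervalIntegral.integral_comp_div (a := 0) (b := a) φ hQ.ne'
  rw [zero_div, smul_eq_mul] at this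
  unfold primitive
  rw [← this, intervalIntegral.integral_of_le ha, ofReal_integral_eq_lintegral_ofReal
    ((intervalIntegrable_iff_integrableOn_Ioc_of_le ha).1 hi)]
  filter_upwards [ae_restrict_mem measurableSet_Ioc] with s hs
  exact (hφ.pos _ (div_pos hs.1 hQ)).le

/-- The increments of the primitive grow at most linearly. -/
theorem primitive_add_mul_sub_le (hφ : IsWeight C φ) {t D c : ℝ} (ht : 0 ≤ t) (hD : 0 ≤ D)
    (hc : 1 ≤ c) :
    primitive φ (t + c * D) - primitive φ t ≤ c * (primitive φ (t + D) - primitive φ t) := by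
  have hc0 : 0 < c := by linarith
  rw [hφ.primitive_sub ht (by positivity), hφ.primitive_sub ht (by positivity)]
  -- Rescaling extracts the factor c; what remains is φ(t + cs) ≤ φ(t + s), true because c ≥ 1 and φ
  -- decreases.
  have h1 : ∫ s in t..t + c * D, φ s = c * ∫ s in (0 : ℝ)..D, φ (t + c * s) := by
    have := intervalIntegral.integral_comp_add_mul (a := 0) (b := D) φ hc0.ne' t
    rw [this, smul_eq_mul, ← mul_assoc, mul_inv_cancel₀ hc0.ne', mul_zero, add_zero, one_mul]
  have h2 : ∫ s in t..t + D, φ s = ∫ s in (0 : ℝ)..D, φ (t + s) := by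
    rw [intervalIntegral.integral_comp_add_left, add_zero]
  rw [h1, h2]
  refine mul_le_mul_of_nonneg_left ?_ hc0.le
  refine intervalIntegral.integral_mono_on_of_le_Ioo hD ?_ ?_ ?_
  · have h := (hφ.intervalIntegrable ht (by positivity : 0 ≤ t + c * D)).comp_add_left t
    have := h.comp_mul_left (c := c)
    simpa [hc0.ne'] using this
  · have := (hφ.intervalIntegrable ht (add_nonneg ht hD)).comp_add_left t
    simpa using this
  · intro s hs
    refine hφ.antitone (mem_Ioi.2 (by linarith [hs.1])) (mem_Ioi.2 ?_) ?_
    · nlinarith [hs.1]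
    · nlinarith [hs.1]

/-- Turns an increment of the primitive back into a length, as long as the interval stays below M,
where φ ≥ φ(M). -/
theorem mul_le_primitive_sub (hφ : IsWeight C φ) {t D M : ℝ} (ht : 0 ≤ t) (hD : 0 ≤ D)
    (hM : t + D ≤ M) (hM0 : 0 < M) : φ M * D ≤ primitive φ (t + D) - primitive φ t := by
  rw [hφ.primitive_sub ht (add_nonneg ht hD)]
  have : ∫ _ in t..t + D, φ M = φ M * D := by
    rw [intervalIntegral.integral_const]; simp [mul_comm]
  rw [← this]
  refine intervalIntegral.integral_mono_on_of_le_Ioo (by linarith) (by simp)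
    (hφ.intervalIntegrable ht (add_nonneg ht hD)) fun s hs => ?_
  exact hφ.antitone (mem_Ioi.2 (by linarith [hs.1])) (mem_Ioi.2 hM0) (by linarith [hs.2])

end IsWeight

/-! ### Curves parametrized by arc length -/

section Curves

variable {X : Type u} [MetricSpace X]

theorem hasUnitSpeedOn_Icc_iff {γ : ℝ → X} {a b : ℝ} :
    HasUnitSpeedOn γ (Icc a b) ↔
      ∀ u v, a ≤ u → u ≤ v → v ≤ b → eVariationOn γ (Icc u v) = ENNReal.ofReal (v - u) := by
  constructor
  · intro h u v hu huv hv
    have := h (⟨hu, huv.trans hv⟩ : u ∈ Icc a b) (⟨hu.trans huv, hv⟩ : v ∈ Icc a b)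
    rwa [inter_eq_right.2 (Icc_subset_Icc hu hv), NNReal.coe_one, one_mul] at this
  · intro h u hu v hv
    rcases le_total u v with huv | huv
    · rw [inter_eq_right.2 (Icc_subset_Icc hu.1 hv.2), NNReal.coe_one, one_mul]
      exact h u v hu.1 huv hv.2
    · rw [eVariationOn.subsingleton, ENNReal.ofReal_of_nonpos]
      · simpa using huv
      · rintro z ⟨_, hz⟩ w ⟨_, hw⟩
        exact le_antisymm (by linarith [hz.2, hw.1]) (by linarith [hw.2, hz.1])

theorem eVariationOn_comp_const_sub (γ : ℝ → X) (c u v : ℝ) :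
    eVariationOn (fun s => γ (c - s)) (Icc u v) = eVariationOn γ (Icc (c - v) (c - u)) := by
  have := eVariationOn.comp_eq_of_antitoneOn γ (t := Icc u v) (fun s => c - s)
    (fun s _ t _ hst => by simp only; linarith)
  rw [image_const_sub_Icc] at this
  exact this

theorem eVariationOn_comp_const_add (γ : ℝ → X) (c u v : ℝ) :
    eVariationOn (fun s => γ (c + s)) (Icc u v) = eVariationOn γ (Icc (c + u) (c + v)) := by
  have := eVariationOn.comp_eq_of_monotoneOn γ (t := Icc u v) (fun s => c + s)
    (fun s _ t _ hst => by simp only; linarith)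
  rw [image_const_add_Icc] at this
  exact this

namespace IsArcLengthCurve

variable {L : ℝ} {γ : ℝ → X} {x y : X}

theorem eVariationOn_eq (h : IsArcLengthCurve L γ x y) {u v : ℝ} (hu : 0 ≤ u) (huv : u ≤ v)
    (hv : v ≤ L) : eVariationOn γ (Icc u v) = ENNReal.ofReal (v - u) :=
  hasUnitSpeedOn_Icc_iff.1 h.unitSpeed u v hu huv hv

theorem reverse (h : IsArcLengthCurve L γ x y) : IsArcLengthCurve L (fun s => γ (L - s)) y x := by
  refine ⟨h.nonneg, hasUnitSpeedOn_Icc_iff.2 fun u v hu huv hv => ?_, by simpa using h.target,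
    by simpa using h.source⟩
  rw [eVariationOn_comp_const_sub, h.eVariationOn_eq (by linarith) (by linarith) (by linarith)]
  congr 1
  ring

theorem sub (h : IsArcLengthCurve L γ x y) {a b : ℝ} (ha : 0 ≤ a) (hab : a ≤ b) (hb : b ≤ L) :
    IsArcLengthCurve (b - a) (fun s => γ (a + s)) (γ a) (γ b) := by
  refine ⟨by linarith, hasUnitSpeedOn_Icc_iff.2 fun u v hu huv hv => ?_, by simp, by simp⟩
  rw [eVariationOn_comp_const_add, h.eVariationOn_eq (by linarith) (by linarith) (by linarith)]
  congr 1
  ring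

theorem initial (h : IsArcLengthCurve L γ x y) {b : ℝ} (hb0 : 0 ≤ b) (hb : b ≤ L) :
    IsArcLengthCurve b γ x (γ b) := by
  have := h.sub le_rfl hb0 hb
  simpa [h.source] using this

theorem trans {M : ℝ} {δ : ℝ → X} {z : X} (h : IsArcLengthCurve L γ x y)
    (k : IsArcLengthCurve M δ y z) :
    IsArcLengthCurve (L + M) (fun s => if s ≤ L then γ s else δ (s - L)) x z := by
  have c2 : ∀ s, L ≤ s → (if s ≤ L then γ s else δ (s - L)) = δ (-L + s) := by
    intro s hs
    rcases hs.eq_or_lt with rfl | hs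
    · simpa using h.target.trans k.source.symm
    · rw [if_neg (not_le.2 hs), neg_add_eq_sub]
  refine ⟨add_nonneg h.nonneg k.nonneg, ?_, ?_, ?_⟩
  · refine HasUnitSpeedOn.Icc_Icc (y := L) ?_ ?_
    · refine hasUnitSpeedOn_Icc_iff.2 fun u v hu huv hv => ?_
      rw [← h.eVariationOn_eq hu huv hv]
      exact eVariationOn.congr fun s hs => if_pos (hs.2.trans hv)
    · refine hasUnitSpeedOn_Icc_iff.2 fun u v hu huv hv => ?_
      rw [eVariationOn.congr (g := fun s => δ (-L + s)) fun s hs => c2 s (hu.trans hs.1),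
        eVariationOn_comp_const_add, k.eVariationOn_eq (by linarith) (by linarith) (by linarith)]
      congr 1
      ring
  · simpa [h.nonneg] using h.source
  · rw [c2 _ (by linarith [k.nonneg])]
    simpa using k.target

theorem dist_le (h : IsArcLengthCurve L γ x y) {u v : ℝ} (hu : 0 ≤ u) (huv : u ≤ v)
    (hv : v ≤ L) : dist (γ u) (γ v) ≤ v - u := by
  rw [dist_edist]
  refine ENNReal.toReal_le_of_le_ofReal (by linarith) ?_
  rw [← h.eVariationOn_eq hu huv hv]
  exact eVariationOn.edist_le _ ⟨le_rfl, huv⟩ ⟨huv, le_rfl⟩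

theorem dist_source_le (h : IsArcLengthCurve L γ x y) {s : ℝ} (hs : 0 ≤ s) (hsL : s ≤ L) :
    dist x (γ s) ≤ s := by
  have := h.dist_le le_rfl hs hsL
  rwa [h.source, sub_zero] at this

theorem dist_le_length (h : IsArcLengthCurve L γ x y) : dist x y ≤ L := by
  have := h.dist_source_le h.nonneg le_rfl
  rwa [h.target] at this

/-- The damped distance between two points of a curve is at most the weighted length of the piece
between them. -/
theorem dampedEDist_le_lintegral (φ : ℝ → ℝ) (h : IsArcLengthCurve L γ x y) {a b : ℝ} (ha : 0 ≤ a)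
    (hab : a ≤ b) (hb : b ≤ L) :
    dampedEDist φ (γ a) (γ b) ≤ ∫⁻ s in Ico a b, ENNReal.ofReal (φ (bdist (γ s))) := by
  refine (dampedEDist_le φ (h.sub ha hab hb)).trans (le_of_eq ?_)
  unfold weightedLength
  -- Half-open intervals make consecutive pieces disjoint, so that their weighted lengths add up as
  -- measures in `eVariationOn_le_measure`.
  rw [setLIntegral_congr Ico_ae_eq_Icc, ← lintegral_indicator measurableSet_Icc,
    ← lintegral_indicator measurableSet_Icc,
    ← lintegral_add_left_eq_self ((Icc a b).indicator
      fun s => ENNReal.ofReal (φ (bdist (γ s)))) a]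
  refine lintegral_congr fun s => ?_
  by_cases hs : s ∈ Icc 0 (b - a)
  · rw [indicator_of_mem hs, indicator_of_mem]
    exact ⟨by linarith [hs.1], by linarith [hs.2]⟩
  · rw [indicator_of_notMem hs, indicator_of_notMem]
    exact fun h => hs ⟨by linarith [h.1], by linarith [h.2]⟩

end IsArcLengthCurve

/-- A rectifiable curve has an arc length parametrization, with control of the lengths of the two
pieces determined by each of its points. -/
theorem IsCurve.exists_arcLength {γ : ℝ → X} {x y : X} (h : IsCurve γ x y)
    (hfin : eVariationOn γ (Icc 0 1) ≠ ⊤) :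
    ∃ (L : ℝ) (δ : ℝ → X), IsArcLengthCurve L δ x y ∧
      eVariationOn γ (Icc 0 1) = ENNReal.ofReal L ∧
      ∀ s ∈ Icc 0 L, ∃ t ∈ Icc (0 : ℝ) 1, δ s = γ t ∧
        eVariationOn γ (Icc 0 t) = ENNReal.ofReal s ∧
        eVariationOn γ (Icc t 1) = ENNReal.ofReal (L - s) := by
  set s : Set ℝ := Icc 0 1 with hs
  have hb : BoundedVariationOn γ s := hfin
  have hl : LocallyBoundedVariationOn γ s := hb.locallyBoundedVariationOn
  have h0 : (0 : ℝ) ∈ s := ⟨le_rfl, zero_le_one⟩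
  have h1 : (1 : ℝ) ∈ s := ⟨zero_le_one, le_rfl⟩
  set V : ℝ → ℝ := variationOnFromTo γ s 0 with hV
  have hV0 : V 0 = 0 := variationOnFromTo.self γ s 0
  have hmono : MonotoneOn V s := variationOnFromTo.monotoneOn hl h0
  -- At a point of continuity of γ the variation over shrinking one-sided intervals tends to 0, and
  -- it dominates the increments of V.
  have hcont : ContinuousOn V s := by
    intro t ht
    have hc : ContinuousWithinAt γ s t := h.continuousOn t ht
    have l1 := hb.tendsto_eVariationOn_Icc_zero_left (hc.mono inter_subset_left)
    have l2 := hb.tendsto_eVariationOn_Icc_zero_right t (hc.mono inter_subset_left)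
    have l1' := (ENNReal.tendsto_toReal ENNReal.zero_ne_top).comp l1
    have l2' := (ENNReal.tendsto_toReal ENNReal.zero_ne_top).comp l2
    have l3 := l1'.add l2'
    rw [ENNReal.toReal_zero, add_zero] at l3
    refine tendsto_iff_dist_tendsto_zero.2 (squeeze_zero' ?_ ?_ l3)
    · exact Eventually.of_forall fun _ => dist_nonneg
    · filter_upwards [self_mem_nhdsWithin] with r hr
      have e : V r - V t = variationOnFromTo γ s t r := by
        rw [sub_eq_iff_eq_add', hV]
        exact (variationOnFromTo.add hl h0 ht hr).symm
      rw [Real.dist_eq, e]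
      rcases le_total t r with htr | hrt
      · rw [variationOnFromTo.eq_of_le γ s htr, abs_of_nonneg ENNReal.toReal_nonneg]
        exact le_add_of_nonneg_left ENNReal.toReal_nonneg
      · rw [variationOnFromTo.eq_of_ge γ s hrt, abs_neg, abs_of_nonneg ENNReal.toReal_nonneg]
        exact le_add_of_nonneg_right ENNReal.toReal_nonneg
  -- The natural parametrization has unit speed on the image of V; continuity of V makes this image
  -- a full interval.
  have himage : V '' s = Icc 0 (V 1) := by
    refine Subset.antisymm ?_ ?_
    · rintro _ ⟨t, ht, rfl⟩
      exact ⟨hV0 ▸ hmono h0 ht ht.1, hmono ht h1 ht.2⟩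
    · have := intermediate_value_Icc zero_le_one hcont
      rwa [hV0] at this
  have hVeq : ∀ a ∈ s, ∀ b ∈ s, a ≤ b → eVariationOn γ (Icc a b) = ENNReal.ofReal (V b - V a) := by
    intro a ha b hb' hab
    have e : V b - V a = variationOnFromTo γ s a b := by
      rw [sub_eq_iff_eq_add', hV]
      exact (variationOnFromTo.add hl h0 ha hb').symm
    rw [e, variationOnFromTo.eq_of_le γ s hab, ENNReal.ofReal_toReal (hl a b ha hb'),
      inter_eq_right.2 (Icc_subset_Icc ha.1 hb'.2)]
  have hpar : ∀ t ∈ s, naturalParameterization γ s 0 (V t) = γ t := fun t ht =>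
    edist_eq_zero.1 (edist_naturalParameterization_eq_zero hl h0 ht)
  refine ⟨V 1, naturalParameterization γ s 0, ⟨hV0 ▸ hmono h0 h1 zero_le_one, ?_, ?_, ?_⟩, ?_, ?_⟩
  · rw [← himage]
    exact has_unit_speed_naturalParameterization γ hl h0
  · have := hpar 0 h0
    rw [hV0] at this
    exact this.trans h.source
  · rw [hpar 1 h1, h.target]
  · rw [hVeq 0 h0 1 h1 zero_le_one, hV0, sub_zero]
  · rw [← himage]
    rintro _ ⟨t, ht, rfl⟩
    refine ⟨t, ht, hpar t ht, ?_, hVeq t ht 1 h1 ht.2⟩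
    rw [hVeq 0 h0 t ht ht.1, hV0, sub_zero]

/-- The variation of a curve is controlled by a measure that controls its increments. -/
theorem eVariationOn_le_measure {Y : Type*} [PseudoEMetricSpace Y] {f : ℝ → Y} {ν : Measure ℝ}
    {a b : ℝ} (h : ∀ u v, a ≤ u → u ≤ v → v ≤ b → edist (f u) (f v) ≤ ν (Ico u v)) :
    eVariationOn f (Icc a b) ≤ ν (Ico a b) := by
  refine iSup_le fun ⟨n, u, hu, hus⟩ => ?_
  have key : ∀ m : ℕ, ∑ i ∈ Finset.range m, edist (f (u (i + 1))) (f (u i))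
      ≤ ν (Ico (u 0) (u m)) := by
    intro m
    induction m with
    | zero => simp
    | succ m ih =>
      rw [Finset.sum_range_succ, ← Ico_union_Ico_eq_Ico (hu (Nat.zero_le m)) (hu m.le_succ),
        measure_union (Ico_disjoint_Ico_same) measurableSet_Ico]
      refine add_le_add ih ?_
      rw [edist_comm]
      exact h _ _ (hus m).1 (hu m.le_succ) (hus _).2
  exact (key n).trans (measure_mono (Ico_subset_Ico (hus 0).1 (hus n).2))

theorem IsUniformCurve.reverse {A : ℝ} {γ : ℝ → X} {x y : X} (h : IsUniformCurve A γ x y) :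
    IsUniformCurve A (fun t => γ (1 - t)) y x := by
  refine ⟨⟨?_, by simpa using h.target, by simpa using h.source⟩, ?_, ?_⟩
  · exact h.continuousOn.comp (by fun_prop) fun t ht => ⟨by linarith [ht.2], by linarith [ht.1]⟩
  · rw [eVariationOn_comp_const_sub, dist_comm]
    simpa using h.length_le
  · intro t ht
    rw [eVariationOn_comp_const_sub, eVariationOn_comp_const_sub, min_comm]
    simpa using h.min_length_le (1 - t) ⟨by linarith [ht.2], by linarith [ht.1]⟩

end Curves

/-! ### Estimates for the damped distance -/

section Estimates

variable {X : Type u} [MetricSpace X]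

theorem bdist_le_add_dist (x y : X) : bdist x ≤ bdist y + dist x y := by
  have := Metric.infDist_le_infDist_add_dist (s := boundary X)
    (x := (x : UniformSpace.Completion X)) (y := (y : UniformSpace.Completion X))
  rwa [UniformSpace.Completion.dist_eq] at this

theorem bdist_nonneg (x : X) : 0 ≤ bdist x := Metric.infDist_nonneg

theorem boundary_nonempty (h : ¬ CompleteSpace X) : (boundary X).Nonempty := by
  by_contra hne
  refine h ?_
  have hr : range ((↑) : X → UniformSpace.Completion X) = univ :=
    compl_empty_iff.1 (not_nonempty_iff_eq_empty.1 hne)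
  have hi := UniformSpace.Completion.isUniformInducing_coe X
  exact (completeSpace_iff_isComplete_range hi).2 (hr ▸ isClosed_univ.isComplete)

namespace IsUniformDomain

variable {C : ℝ}

theorem isClosed_boundary (hX : IsUniformDomain C X) : IsClosed (boundary X) :=
  hX.isOpen_range.isClosed_compl

theorem bdist_pos (hX : IsUniformDomain C X) (x : X) : 0 < bdist x :=
  (hX.isClosed_boundary.notMem_iff_infDist_pos (boundary_nonempty hX.not_complete)).1
    fun h => h ⟨x, rfl⟩

theorem exists_arcLength (hX : IsUniformDomain C X) (x y : X) :
    ∃ (L : ℝ) (γ : ℝ → X), IsArcLengthCurve L γ x y ∧ L ≤ C * dist x y ∧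
      ∀ s ∈ Icc 0 L, min s (L - s) ≤ C * bdist (γ s) := by
  by_cases hxy : x = y
  · subst hxy
    refine ⟨0, fun _ => x, ⟨le_rfl, hasConstantSpeedOnWith_of_subsingleton _ (by simp) _, rfl, rfl⟩,
      by simp, fun s hs => ?_⟩
    exact (min_le_left _ _).trans
      (hs.2.trans (mul_nonneg (zero_le_one.trans hX.one_le) (bdist_nonneg _)))
  · obtain ⟨γ, hγ⟩ := hX.exists_curve x y hxy
    have hC : 0 ≤ C := zero_le_one.trans hX.one_le
    obtain ⟨L, δ, hδ, hL, h⟩ := hγ.toIsCurve.exists_arcLength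
      (ne_top_of_le_ne_top ENNReal.ofReal_ne_top hγ.length_le)
    refine ⟨L, δ, hδ, ?_, fun s hs => ?_⟩
    · have := hγ.length_le
      rw [hL] at this
      exact (ENNReal.ofReal_le_ofReal_iff (mul_nonneg hC dist_nonneg)).1 this
    · obtain ⟨t, ht, e, h1, h2⟩ := h s hs
      have := hγ.min_length_le t ht
      rw [h1, h2, ← e] at this
      rcases min_le_iff.1 this with h | h
      · exact min_le_of_left_le
          ((ENNReal.ofReal_le_ofReal_iff (mul_nonneg hC (bdist_nonneg _))).1 h)
      · exact min_le_of_right_le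
          ((ENNReal.ofReal_le_ofReal_iff (mul_nonneg hC (bdist_nonneg _))).1 h)

end IsUniformDomain

section Weight

variable {C : ℝ} {φ : ℝ → ℝ}

/-- A curve from x to y has length at least `dist x y`, and after arc length s its boundary distance
is at most `bdist x + s`; φ is decreasing. -/
theorem ofReal_primitive_sub_le_dampedEDist (hφ : IsWeight C φ) (hpos : ∀ x : X, 0 < bdist x)
    (x y : X) :
    ENNReal.ofReal (primitive φ (bdist x + dist x y) - primitive φ (bdist x))
      ≤ dampedEDist φ x y := by
  refine le_iInf fun L => le_iInf fun γ => le_iInf fun h => ?_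
  rw [← hφ.lintegral_add_left (bdist_nonneg x) dist_nonneg]
  refine (setLIntegral_mono' measurableSet_Ioc fun s hs => ?_).trans
    (lintegral_mono_set (Ioc_subset_Icc_self.trans (Icc_subset_Icc_right h.dist_le_length)))
  refine ENNReal.ofReal_le_ofReal (hφ.antitone (hpos _) ?_ ?_)
  · exact mem_Ioi.2 (add_pos (hpos x) hs.1)
  · have h1 := bdist_le_add_dist (γ s) x
    have h2 := h.dist_source_le hs.1.le (hs.2.trans h.dist_le_length)
    rw [dist_comm] at h2
    linarith

theorem dampedEDist_le_length (hφ : IsWeight C φ) (hpos : ∀ x : X, 0 < bdist x) {L : ℝ}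
    {γ : ℝ → X} {x y : X} (h : IsArcLengthCurve L γ x y) :
    dampedEDist φ x y ≤ ENNReal.ofReal L := by
  refine (dampedEDist_le φ h).trans ?_
  calc weightedLength φ L γ ≤ ∫⁻ _ in Icc 0 L, 1 := by
        refine lintegral_mono fun s => ?_
        rw [← ENNReal.ofReal_one]
        exact ENNReal.ofReal_le_ofReal (hφ.le_one (hpos _))
    _ = ENNReal.ofReal L := by simp

/-- The exponent that turns the doubling condition into a comparison of the values of a weight at
points whose ratio is at most `2 * Q + 1`. -/
noncomputable def doublingExponent (Q : ℝ) : ℕ := ⌈2 * Q + 1⌉₊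

theorem le_two_pow_doublingExponent (Q : ℝ) : 2 * Q + 1 ≤ 2 ^ doublingExponent Q := by
  refine (Nat.le_ceil _).trans ?_
  exact_mod_cast (Nat.lt_two_pow_self).le

/-- Along the curve `γ : [0,a] → X` from `x`, the distance to the boundary is at least comparable
to the distance to `x` along the curve. -/
structure IsCigarFrom (Q : ℝ) (a : ℝ) (γ : ℝ → X) : Prop where
  pos : 0 < Q
  le_bdist : ∀ s ∈ Icc 0 a, s ≤ Q * bdist (γ s)

namespace IsCigarFrom

variable {Q a : ℝ} {γ : ℝ → X} {x y : X}

theorem initial (hQ : IsCigarFrom Q a γ) {b : ℝ} (hb : b ≤ a) : IsCigarFrom Q b γ :=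
  ⟨hQ.pos, fun s hs => hQ.le_bdist s ⟨hs.1, hs.2.trans hb⟩⟩

/-- Since `bdist x` exceeds `bdist (γ s)` by at most s, the left side is at most `bdist (γ s) + 2 *
s`. Keeping `bdist x` in the bound is what makes it match the lower estimate for d_φ. -/
theorem add_le (hQ : IsCigarFrom Q a γ) (h : IsArcLengthCurve a γ x y) {s : ℝ}
    (hs : s ∈ Icc 0 a) : bdist x + s ≤ (2 * Q + 1) * bdist (γ s) := by
  have h1 := bdist_le_add_dist x (γ s)
  have h2 := h.dist_source_le hs.1 hs.2
  have h3 := hQ.le_bdist s hs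
  linarith

/-- Converse, up to a doubling constant, of `ofReal_primitive_sub_le_dampedEDist`: by `add_le` and
doubling, φ at `γ s` is at most a constant times φ(bdist x + s). -/
theorem lintegral_le (hQ : IsCigarFrom Q a γ) (hφ : IsWeight C φ) (hpos : ∀ x : X, 0 < bdist x)
    (h : IsArcLengthCurve a γ x y) :
    ∫⁻ s in Ico 0 a, ENNReal.ofReal (φ (bdist (γ s))) ≤
      ENNReal.ofReal (C ^ doublingExponent Q *
        (primitive φ (bdist x + a) - primitive φ (bdist x))) := by
  have hC : 0 ≤ C ^ doublingExponent Q := pow_nonneg (zero_le_one.trans hφ.one_le) _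
  rw [setLIntegral_congr Ico_ae_eq_Ioc, ENNReal.ofReal_mul hC,
    ← hφ.lintegral_add_left (bdist_nonneg x) h.nonneg,
    ← lintegral_const_mul' _ _ ENNReal.ofReal_ne_top]
  refine setLIntegral_mono' measurableSet_Ioc fun s hs => ?_
  rw [← ENNReal.ofReal_mul hC]
  refine ENNReal.ofReal_le_ofReal (hφ.le_pow_mul_of_le (hpos _) (add_pos (hpos x) hs.1) ?_)
  exact (hQ.add_le h (Ioc_subset_Icc_self hs)).trans
    (mul_le_mul_of_nonneg_right (le_two_pow_doublingExponent Q) (bdist_nonneg _))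

/-- Here only `bdist (γ s) ≥ s / Q` enters, so the bound involves the end of the piece and not its
starting point. It is the source of the cigar condition for d_φ. -/
theorem lintegral_le_primitive (hQ : IsCigarFrom Q a γ) (hφ : IsWeight C φ)
    (hpos : ∀ x : X, 0 < bdist x) (ha : 0 ≤ a) :
    ∫⁻ s in Ico 0 a, ENNReal.ofReal (φ (bdist (γ s))) ≤
      ENNReal.ofReal (Q * primitive φ (bdist (γ a))) := by
  rw [setLIntegral_congr Ico_ae_eq_Ioc]
  calc ∫⁻ s in Ioc 0 a, ENNReal.ofReal (φ (bdist (γ s)))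
      ≤ ∫⁻ s in Ioc 0 a, ENNReal.ofReal (φ (s / Q)) := by
        refine setLIntegral_mono' measurableSet_Ioc fun s hs => ENNReal.ofReal_le_ofReal ?_
        refine hφ.antitone (mem_Ioi.2 (div_pos hs.1 hQ.pos)) (hpos _) ?_
        rw [div_le_iff₀' hQ.pos]
        exact hQ.le_bdist s (Ioc_subset_Icc_self hs)
    _ = ENNReal.ofReal (Q * primitive φ (a / Q)) := hφ.lintegral_div hQ.pos ha
    _ ≤ _ := by
        refine ENNReal.ofReal_le_ofReal (mul_le_mul_of_nonneg_left ?_ hQ.pos.le)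
        refine hφ.primitive_le (div_nonneg ha hQ.pos.le) ?_
        rw [div_le_iff₀' hQ.pos]
        exact hQ.le_bdist a ⟨ha, le_rfl⟩

end IsCigarFrom

end Weight

/-! ### Curves to infinity -/

/-- The ratio between the arc length of the curves of `exists_ray` and the distance to the
boundary along them. -/
def rayConstant (C : ℝ) : ℝ := 2 * C * (2 * C + 1)

namespace IsUniformDomain

variable {C : ℝ}

/-- Head for a point at distance at least `4 * C * bdist y`, but follow the uniform curve only for
arc length `k = 2 * C * bdist y`. This stays in its first half, where arc length is at most C times
the boundary distance; at the end of the piece `bdist` has therefore doubled, which restores the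
bound on the total length. -/
theorem exists_cigar_extension (hX : IsUniformDomain C X) (hub : ¬ BoundedSpace X)
    {S : ℝ} {γ : ℝ → X} {x y : X} (h : IsArcLengthCurve S γ x y)
    (hQ : IsCigarFrom (2 * C * (2 * C + 1)) S γ) (hS : S ≤ 2 * C * bdist y) :
    ∃ (S' : ℝ) (γ' : ℝ → X) (y' : X), IsArcLengthCurve S' γ' x y' ∧
      IsCigarFrom (2 * C * (2 * C + 1)) S' γ' ∧ S' ≤ 2 * C * bdist y' ∧
      S + 2 * C * bdist y ≤ S' ∧ 2 * bdist y ≤ bdist y' ∧ EqOn γ γ' (Icc 0 S) := by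
  have hC := hX.one_le
  have ht := hX.bdist_pos y
  obtain ⟨z, hz⟩ : ∃ z, 4 * C * bdist y ≤ dist y z := by
    by_contra! hcon
    refine hub ⟨(Metric.isBounded_iff_subset_ball y).2 ⟨4 * C * bdist y, fun z _ => ?_⟩⟩
    rw [Metric.mem_ball, dist_comm]
    exact hcon z
  obtain ⟨L, η, hη, -, hmin⟩ := hX.exists_arcLength y z
  have hL := hz.trans hη.dist_le_length
  set k : ℝ := 2 * C * bdist y with hk
  have hk0 : 0 ≤ k := by positivity
  have hcig : IsCigarFrom C k η := by
    refine ⟨by linarith, fun s hs => ?_⟩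
    have := hmin s ⟨hs.1, by linarith [hs.2]⟩
    rwa [min_eq_left (by linarith [hs.2])] at this
  have hη' := hη.initial hk0 (by linarith : k ≤ L)
  have hend := hcig.le_bdist k ⟨hk0, le_rfl⟩
  have hend' : 2 * bdist y ≤ bdist (η k) := by
    have : C * (2 * bdist y) ≤ C * bdist (η k) := by linarith
    exact le_of_mul_le_mul_left this (by linarith)
  refine ⟨S + k, _, η k, h.trans hη', ⟨hQ.pos, fun s hs => ?_⟩, ?_, le_rfl, hend',
    fun s hs => (if_pos hs.2).symm⟩
  · by_cases hsS : s ≤ S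
    · simp only [if_pos hsS]
      exact hQ.le_bdist s ⟨hs.1, hsS⟩
    · simp only [if_neg hsS]
      push Not at hsS
      have h1 := hcig.add_le hη' (s := s - S) ⟨by linarith, by linarith [hs.2]⟩
      -- The old part has length at most k, that is, `2 * C * bdist y`, and `IsCigarFrom.add_le` for
      -- the new piece supplies the factor `2 * C + 1`: the product is the ray constant.
      calc s ≤ k + (s - S) := by linarith
        _ ≤ 2 * C * (bdist y + (s - S)) := by
          rw [mul_add, ← hk]
          nlinarith
        _ ≤ 2 * C * ((2 * C + 1) * bdist (η (s - S))) := by gcongr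
        _ = _ := by ring
  · nlinarith

/-- From each point starts an infinite curve, parametrized by arc length, along which the distance
to the boundary grows at least linearly. -/
theorem exists_ray (hX : IsUniformDomain C X) (hub : ¬ BoundedSpace X) (x : X) :
    ∃ γ : ℝ → X, ∀ S, 0 ≤ S → IsArcLengthCurve S γ x (γ S) ∧
      IsCigarFrom (rayConstant C) S γ := by
  unfold rayConstant
  have hC := hX.one_le
  -- The last clause makes each extension add at least `bdist x` to the length, so the lengths are
  -- unbounded.
  let P : ℝ × (ℝ → X) × X → Prop := fun p => IsArcLengthCurve p.1 p.2.1 x p.2.2 ∧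
    IsCigarFrom (2 * C * (2 * C + 1)) p.1 p.2.1 ∧ p.1 ≤ 2 * C * bdist p.2.2 ∧
    bdist x ≤ bdist p.2.2
  have hstep : ∀ p : {p // P p}, ∃ q : {p // P p},
      p.1.1 + bdist x ≤ q.1.1 ∧ EqOn p.1.2.1 q.1.2.1 (Icc 0 p.1.1) := by
    rintro ⟨⟨S, γ, y⟩, h, hQ, hS, hy⟩
    obtain ⟨S', γ', y', h1, h2, h3, h4, h5, h6⟩ := hX.exists_cigar_extension hub h hQ hS
    have h0 := hX.bdist_pos y
    simp only at hy
    exact ⟨⟨⟨S', γ', y'⟩, h1, h2, h3, by simp only; linarith⟩, by simp only; nlinarith, h6⟩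
  choose next hnext1 hnext2 using hstep
  have hinit : P (0, fun _ => x, x) := by
    refine ⟨⟨le_rfl, hasConstantSpeedOnWith_of_subsingleton _ (by simp) _, rfl, rfl⟩,
      ⟨by positivity, fun s hs => hs.2.trans ?_⟩, ?_, le_rfl⟩
    · exact mul_nonneg (by positivity) (bdist_nonneg _)
    · exact mul_nonneg (by positivity) (bdist_nonneg _)
  let p : ℕ → {p // P p} := fun n => next^[n] ⟨_, hinit⟩
  have hp : ∀ n, p (n + 1) = next (p n) := fun n => Function.iterate_succ_apply' _ _ _
  have hx := hX.bdist_pos x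
  have hmono : Monotone fun n => (p n).1.1 := monotone_nat_of_le_succ fun n => by
    have := hnext1 (p n)
    simp only [hp]
    linarith
  have hlin : ∀ n : ℕ, n * bdist x ≤ (p n).1.1 := by
    intro n
    induction n with
    | zero => simpa using (p 0).2.1.nonneg
    | succ n ih =>
      have := hnext1 (p n)
      rw [← hp] at this
      push_cast
      linarith
  have heq : ∀ m n, m ≤ n → EqOn (p m).1.2.1 (p n).1.2.1 (Icc 0 (p m).1.1) := by
    intro m n hmn
    induction n, hmn using Nat.le_induction with
    | base => exact fun _ _ => rfl
    | succ n hmn ih =>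
      refine ih.trans ?_
      rw [hp]
      exact (hnext2 (p n)).mono (Icc_subset_Icc_right (hmono hmn))
  have hex : ∀ s : ℝ, ∃ n : ℕ, s ≤ (p n).1.1 := by
    intro s
    obtain ⟨n, hn⟩ := exists_nat_ge (s / bdist x)
    exact ⟨n, ((div_le_iff₀ hx).1 hn).trans (hlin n)⟩
  choose N hN using hex
  -- The choice of `N s` is immaterial, since the successive curves extend one another.
  let γ : ℝ → X := fun s => (p (N s)).1.2.1 s
  have hγ : ∀ n, EqOn γ (p n).1.2.1 (Icc 0 (p n).1.1) := by
    intro n s hs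
    rcases le_total n (N s) with h | h
    · exact (heq n (N s) h hs).symm
    · exact heq (N s) n h ⟨hs.1, hN s⟩
  refine ⟨γ, fun S hS => ⟨⟨hS, hasUnitSpeedOn_Icc_iff.2 fun u v hu huv hv => ?_, ?_, rfl⟩,
    by positivity, fun s hs => ?_⟩⟩
  · rw [← (p (N S)).2.1.eVariationOn_eq hu huv (hv.trans (hN S))]
    exact eVariationOn.congr fun s hs =>
      hγ (N S) ⟨hu.trans hs.1, (hs.2.trans hv).trans (hN S)⟩
  · exact (p (N 0)).2.1.source
  · exact (p (N s)).2.2.1.le_bdist s ⟨hs.1, hN s⟩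

end IsUniformDomain

end Estimates

/-! ### The damped metric and its completion -/

section DampedMetric

variable {X : Type u} [MetricSpace X] {CU C : ℝ} {φ : ℝ → ℝ}

theorem edist_toDamped (hX : RectifiablyConnected X) (hφ : IsWeight C φ) (x y : X) :
    edist (toDamped hX hφ x) (toDamped hX hφ y) = dampedEDist φ x y := by
  rw [edist_dist]
  exact ENNReal.ofReal_toReal (dampedEDist_ne_top hX hφ x y)

namespace IsUniformDomain

variable (hU : IsUniformDomain CU X) (hφ : IsWeight C φ)


/-- The inclusion of `X` into the completion for the damped metric. -/
noncomputable def toCompletion (x : X) : DampedCompletion hU.rectifiablyConnected hφ :=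
  (toDamped hU.rectifiablyConnected hφ x : DampedCompletion hU.rectifiablyConnected hφ)

theorem edist_toCompletion (x y : X) :
    edist (hU.toCompletion hφ x) (hU.toCompletion hφ y) = dampedEDist φ x y := by
  rw [← edist_toDamped hU.rectifiablyConnected hφ]
  exact UniformSpace.Completion.edist_eq _ _

theorem dist_toCompletion_le_iff {x y : X} {r : ℝ} (hr : 0 ≤ r) :
    dist (hU.toCompletion hφ x) (hU.toCompletion hφ y) ≤ r ↔
      dampedEDist φ x y ≤ ENNReal.ofReal r := by
  rw [← hU.edist_toCompletion hφ, edist_dist, ENNReal.ofReal_le_ofReal_iff hr]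

theorem denseRange_toCompletion : DenseRange (hU.toCompletion hφ) :=
  UniformSpace.Completion.denseRange_coe (α := Damped hU.rectifiablyConnected hφ)

theorem primitive_sub_le_dist (x y : X) :
    primitive φ (bdist x + dist x y) - primitive φ (bdist x) ≤
      dist (hU.toCompletion hφ x) (hU.toCompletion hφ y) := by
  have h := ofReal_primitive_sub_le_dampedEDist hφ hU.bdist_pos x y
  rw [← hU.edist_toCompletion hφ, edist_dist] at h
  exact (ENNReal.ofReal_le_ofReal_iff dist_nonneg).1 h

theorem abs_primitive_sub_le_dist (x y : X) :
    |primitive φ (bdist x) - primitive φ (bdist y)| ≤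
      dist (hU.toCompletion hφ x) (hU.toCompletion hφ y) := by
  have key : ∀ x y : X, primitive φ (bdist y) - primitive φ (bdist x) ≤
      dist (hU.toCompletion hφ x) (hU.toCompletion hφ y) := fun x y => by
    refine le_trans (sub_le_sub_right (hφ.primitive_le (bdist_nonneg y) ?_) _)
      (hU.primitive_sub_le_dist hφ x y)
    rw [dist_comm]
    exact bdist_le_add_dist y x
  refine abs_sub_le_iff.2 ⟨?_, key x y⟩
  rw [dist_comm]
  exact key y x

/-- Truncating the distance at 1 keeps the interval of integration below M + 1, where φ ≥ φ(M + 1).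
Only one of the two points needs bounded boundary distance; all comparisons of topologies rest on
this. -/
theorem mul_min_dist_le {M : ℝ} {x : X} (hM : bdist x ≤ M) (y : X) :
    φ (M + 1) * min (dist x y) 1 ≤ dist (hU.toCompletion hφ x) (hU.toCompletion hφ y) := by
  have hx := hU.bdist_pos x
  have hm : 0 ≤ min (dist x y) 1 := le_min dist_nonneg zero_le_one
  have h1 := min_le_left (dist x y) 1
  have h2 := min_le_right (dist x y) 1
  refine (hφ.mul_le_primitive_sub hx.le hm (by linarith) (by linarith)).trans
    (le_trans ?_ (hU.primitive_sub_le_dist hφ x y))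
  exact sub_le_sub_right (hφ.primitive_le (by linarith) (by linarith)) _

theorem dist_toCompletion_le_mul (x y : X) :
    dist (hU.toCompletion hφ x) (hU.toCompletion hφ y) ≤ CU * dist x y := by
  obtain ⟨L, γ, h, hL, -⟩ := hU.exists_arcLength x y
  rw [hU.dist_toCompletion_le_iff hφ (h.nonneg.trans hL)]
  exact (dampedEDist_le_length hφ hU.bdist_pos h).trans (ENNReal.ofReal_le_ofReal hL)

theorem lipschitzWith_toDamped :
    LipschitzWith (Real.toNNReal CU) (toDamped hU.rectifiablyConnected hφ) :=
  LipschitzWith.of_dist_le' fun x y => by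
    rw [← UniformSpace.Completion.dist_eq]
    exact hU.dist_toCompletion_le_mul hφ x y

theorem lipschitzWith_closureMap :
    LipschitzWith (Real.toNNReal CU) (closureMap hU.rectifiablyConnected hφ) :=
  (hU.lipschitzWith_toDamped hφ).completion_map

@[simp]
theorem closureMap_coe (x : X) :
    closureMap hU.rectifiablyConnected hφ x = hU.toCompletion hφ x :=
  UniformSpace.Completion.map_coe (hU.lipschitzWith_toDamped hφ).uniformContinuous x

theorem le_rayConstant (hU : IsUniformDomain CU X) : CU ≤ rayConstant CU := by
  have := hU.one_le
  unfold rayConstant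
  nlinarith

/-- Cut at its midpoint, a uniform curve is a cigar from either end. The constant is enlarged to the
ray constant so that the same estimates serve curves and rays. -/
theorem exists_cigars (hU : IsUniformDomain CU X) (x y : X) :
    ∃ (L : ℝ) (γ : ℝ → X), IsArcLengthCurve L γ x y ∧ L ≤ CU * dist x y ∧
      IsCigarFrom (rayConstant CU) (L / 2) γ ∧
      IsCigarFrom (rayConstant CU) (L / 2) (fun s => γ (L - s)) := by
  obtain ⟨L, γ, h, hL, hmin⟩ := hU.exists_arcLength x y
  have h0 := hU.one_le
  have hpos : 0 < rayConstant CU := by linarith [hU.le_rayConstant]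
  refine ⟨L, γ, h, hL, ⟨hpos, fun s hs => ?_⟩, hpos, fun s hs => ?_⟩
  · have := hmin s ⟨hs.1, by linarith [hs.1, hs.2]⟩
    rw [min_eq_left (by linarith [hs.2])] at this
    exact this.trans (mul_le_mul_of_nonneg_right hU.le_rayConstant (bdist_nonneg _))
  · have := hmin (L - s) ⟨by linarith [hs.1, hs.2], by linarith [hs.1]⟩
    rw [min_eq_right (by linarith [hs.2]), sub_sub_cancel] at this
    exact this.trans (mul_le_mul_of_nonneg_right hU.le_rayConstant (bdist_nonneg _))

/-- The damped distance is controlled by the primitive of the weight near infinity. -/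
theorem dist_toCompletion_le_integral (x y : X) :
    dist (hU.toCompletion hφ x) (hU.toCompletion hφ y) ≤
      C ^ doublingExponent (rayConstant CU) *
        (((∫ s in Ioi 0, φ s) - primitive φ (bdist x)) +
          ((∫ s in Ioi 0, φ s) - primitive φ (bdist y))) := by
  have hC : 0 ≤ C ^ doublingExponent (rayConstant CU) :=
    pow_nonneg (zero_le_one.trans hφ.one_le) _
  -- Each half of a uniform curve costs at most a constant times the tail of the integral of φ
  -- beyond `bdist` of its end point.
  have key : ∀ {a : ℝ} {γ : ℝ → X} {x z : X}, IsArcLengthCurve a γ x z →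
      IsCigarFrom (rayConstant CU) a γ →
      dist (hU.toCompletion hφ x) (hU.toCompletion hφ z) ≤
        C ^ doublingExponent (rayConstant CU) *
          ((∫ s in Ioi 0, φ s) - primitive φ (bdist x)) := by
    intro a γ x z h hQ
    have hx := bdist_nonneg x
    have ha := h.nonneg
    rw [hU.dist_toCompletion_le_iff hφ
      (mul_nonneg hC (sub_nonneg.2 (hφ.primitive_le_integral hx)))]
    have := h.dampedEDist_le_lintegral φ le_rfl ha le_rfl
    rw [h.source, h.target] at this
    refine this.trans ((hQ.lintegral_le hφ hU.bdist_pos h).trans (ENNReal.ofReal_le_ofReal ?_))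
    exact mul_le_mul_of_nonneg_left
      (sub_le_sub_right (hφ.primitive_le_integral (by linarith)) _) hC
  obtain ⟨L, γ, h, -, h1, h2⟩ := hU.exists_cigars x y
  have hL := h.nonneg
  have k1 := key (h.initial (by linarith) (by linarith : L / 2 ≤ L)) h1
  have k2 := key (h.reverse.initial (by linarith) (by linarith : L / 2 ≤ L)) h2
  simp only [sub_half] at k2
  rw [mul_add]
  refine (dist_triangle_right _ _ _).trans (add_le_add k1 k2)

theorem boundedSpace_completion : BoundedSpace (DampedCompletion hU.rectifiablyConnected hφ) := by
  have hC : 0 ≤ C ^ doublingExponent (rayConstant CU) :=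
    pow_nonneg (zero_le_one.trans hφ.one_le) _
  rw [← Bornology.isBounded_univ, ← (hU.denseRange_toCompletion hφ).closure_range]
  refine Bornology.IsBounded.closure (Metric.isBounded_iff.2
    ⟨C ^ doublingExponent (rayConstant CU) * ((∫ s in Ioi 0, φ s) + ∫ s in Ioi 0, φ s), ?_⟩)
  rintro _ ⟨x, rfl⟩ _ ⟨y, rfl⟩
  refine (hU.dist_toCompletion_le_integral hφ x y).trans (mul_le_mul_of_nonneg_left ?_ hC)
  linarith [hφ.primitive_nonneg (bdist_nonneg x), hφ.primitive_nonneg (bdist_nonneg y)]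

/-! ### The height function -/

/-- The function `x ↦ ∫_0^{d(x)} φ`, where `d` is the distance to the boundary. -/
noncomputable def preHeight : Damped hU.rectifiablyConnected hφ → ℝ :=
  fun x : X => primitive φ (bdist x)

/-- The extension of `x ↦ ∫_0^{d(x)} φ`, where `d` is the distance to the boundary, to the
completion for the damped metric. -/
noncomputable def height : DampedCompletion hU.rectifiablyConnected hφ → ℝ :=
  UniformSpace.Completion.extension (hU.preHeight hφ)

theorem lipschitzWith_preHeight : LipschitzWith 1 (hU.preHeight hφ) :=
  LipschitzWith.of_dist_le_mul fun x y => by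
    rw [NNReal.coe_one, one_mul, ← UniformSpace.Completion.dist_eq x y]
    exact hU.abs_primitive_sub_le_dist hφ x y

theorem lipschitzWith_height : LipschitzWith 1 (hU.height hφ) :=
  (hU.lipschitzWith_preHeight hφ).completion_extension

theorem continuous_height : Continuous (hU.height hφ) :=
  (hU.lipschitzWith_height hφ).continuous

theorem height_sub_le_dist (p q : DampedCompletion hU.rectifiablyConnected hφ) :
    hU.height hφ p - hU.height hφ q ≤ dist p q := by
  have := (hU.lipschitzWith_height hφ).dist_le_mul p q
  rw [NNReal.coe_one, one_mul] at this
  exact (le_abs_self _).trans this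

@[simp]
theorem height_toCompletion (x : X) :
    hU.height hφ (hU.toCompletion hφ x) = primitive φ (bdist x) :=
  UniformSpace.Completion.extension_coe
    (hU.lipschitzWith_preHeight hφ).uniformContinuous _

theorem height_nonneg (p : DampedCompletion hU.rectifiablyConnected hφ) : 0 ≤ hU.height hφ p := by
  induction p using (hU.denseRange_toCompletion hφ).induction_on with
  | hp => exact isClosed_le continuous_const (hU.continuous_height hφ)
  | ih x =>
    rw [height_toCompletion]
    exact hφ.primitive_nonneg (bdist_nonneg x)

/-- From φ ≤ 1, the height is at most the distance to the boundary on `X`, hence on its completion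
by density. -/
theorem height_closureMap {ζ : UniformSpace.Completion X} (hζ : ζ ∈ boundary X) :
    hU.height hφ (closureMap hU.rectifiablyConnected hφ ζ) = 0 := by
  have key : ∀ q : UniformSpace.Completion X,
      hU.height hφ (closureMap hU.rectifiablyConnected hφ q) ≤ Metric.infDist q (boundary X) := by
    intro q
    induction q using UniformSpace.Completion.induction_on with
    | hp =>
      exact isClosed_le ((hU.continuous_height hφ).comp (hU.lipschitzWith_closureMap hφ).continuous)
        (Metric.continuous_infDist_pt _)
    | ih x =>
      rw [hU.closureMap_coe hφ, height_toCompletion]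
      change primitive φ (bdist x) ≤ bdist x
      have hx := hU.bdist_pos x
      calc primitive φ (bdist x) ≤ ∫ _ in (0 : ℝ)..bdist x, (1 : ℝ) :=
            intervalIntegral.integral_mono_on_of_le_Ioo hx.le
              (hφ.intervalIntegrable le_rfl hx.le) (by simp) fun s hs => hφ.le_one hs.1
        _ = bdist x := by simp
  refine le_antisymm ?_ (hU.height_nonneg hφ _)
  rw [← Metric.infDist_zero_of_mem hζ]
  exact key ζ

/-! ### The point at infinity -/

/-- This filter stands for the punctured neighbourhoods of infinity. Unboundedness alone would not
make it proper; a ray, on which `bdist` grows linearly, does. -/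
theorem comap_bdist_atTop_neBot (hU : IsUniformDomain CU X) (hub : ¬ BoundedSpace X) :
    (comap (bdist : X → ℝ) atTop).NeBot := by
  refine comap_neBot_iff_frequently.2 (frequently_atTop.2 ?_)
  intro M
  obtain ⟨x⟩ : Nonempty X := by
    by_contra h
    rw [not_nonempty_iff] at h
    exact hub inferInstance
  obtain ⟨γ, hγ⟩ := hU.exists_ray hub x
  have hQ := hU.le_rayConstant
  have h1 := hU.one_le
  have hQ0 : 0 < rayConstant CU := by linarith
  have hS : 0 ≤ rayConstant CU * max M 0 := mul_nonneg hQ0.le (le_max_right _ _)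
  have := (hγ _ hS).2.le_bdist _ ⟨hS, le_rfl⟩
  exact ⟨_, (le_max_left M 0).trans (le_of_mul_le_mul_left this hQ0), _, rfl⟩

theorem exists_infinity (hub : ¬ BoundedSpace X) :
    ∃ p : DampedCompletion hU.rectifiablyConnected hφ,
      Tendsto (hU.toCompletion hφ) (comap bdist atTop) (𝓝 p) := by
  have := hU.comap_bdist_atTop_neBot hub
  refine CompleteSpace.complete (Metric.cauchy_iff.2 ⟨inferInstance, fun ε hε => ?_⟩)
  have hC : 0 < C ^ doublingExponent (rayConstant CU) :=
    pow_pos (zero_lt_one.trans_le hφ.one_le) _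
  set K := C ^ doublingExponent (rayConstant CU)
  have hev : ∀ᶠ t in atTop, (∫ s in Ioi 0, φ s) - ε / (2 * K) < primitive φ t :=
    hφ.tendsto_primitive.eventually_const_lt (sub_lt_self _ (by positivity))
  refine ⟨_, image_mem_map (preimage_mem_comap hev), ?_⟩
  rintro _ ⟨x, hx, rfl⟩ _ ⟨y, hy, rfl⟩
  refine (hU.dist_toCompletion_le_integral hφ x y).trans_lt ?_
  change _ < primitive φ (bdist x) at hx
  change _ < primitive φ (bdist y) at hy
  calc _ < K * (ε / (2 * K) + ε / (2 * K)) := by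
        refine mul_lt_mul_of_pos_left ?_ hC
        linarith
    _ = ε := by field_simp; ring

/-- The limit in the damped completion of the points that move away from the boundary. -/
noncomputable def infinity (hub : ¬ BoundedSpace X) :
    DampedCompletion hU.rectifiablyConnected hφ :=
  (hU.exists_infinity hφ hub).choose

theorem tendsto_infinity (hub : ¬ BoundedSpace X) :
    Tendsto (hU.toCompletion hφ) (comap bdist atTop) (𝓝 (hU.infinity hφ hub)) :=
  (hU.exists_infinity hφ hub).choose_spec

theorem height_infinity (hub : ¬ BoundedSpace X) :
    hU.height hφ (hU.infinity hφ hub) = ∫ s in Ioi 0, φ s := by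
  have := hU.comap_bdist_atTop_neBot hub
  refine tendsto_nhds_unique
    (((hU.continuous_height hφ).tendsto _).comp (hU.tendsto_infinity hφ hub)) ?_
  refine (hφ.tendsto_primitive.comp tendsto_comap).congr fun x => ?_
  exact (hU.height_toCompletion hφ x).symm

/-- Consider the trace on `X` of the neighbourhoods of p. If `bdist` tends to infinity along it,
then p is the point at infinity. Otherwise `bdist` is frequently bounded, the trace is Cauchy for
the original metric, and p is the image of its limit. -/
theorem eq_infinity_or_mem_range (hub : ¬ BoundedSpace X)
    (p : DampedCompletion hU.rectifiablyConnected hφ) :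
    p = hU.infinity hφ hub ∨ p ∈ range (closureMap hU.rectifiablyConnected hφ) := by
  set l := comap (hU.toCompletion hφ) (𝓝 p) with hl
  have hne : l.NeBot :=
    UniformSpace.Completion.isDenseInducing_coe.comap_nhds_neBot p
  have hlp : Tendsto (hU.toCompletion hφ) l (𝓝 p) := tendsto_comap
  by_cases htop : Tendsto bdist l atTop
  · exact Or.inl (tendsto_nhds_unique hlp
      ((hU.tendsto_infinity hφ hub).mono_left (tendsto_iff_comap.1 htop)))
  right
  obtain ⟨M, hM⟩ : ∃ M, ∃ᶠ x in l, bdist x ≤ M := by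
    rw [tendsto_atTop] at htop
    push Not at htop
    obtain ⟨M, hM⟩ := htop
    exact ⟨M, hM.mono fun x hx => hx.le⟩
  have hcau : Cauchy (map (hU.toCompletion hφ) l) := (Filter.Tendsto.cauchy_map hlp)
  have hsmall : ∀ ε > 0, ∃ t ∈ l, ∀ x ∈ t, ∀ y ∈ t,
      dist (hU.toCompletion hφ x) (hU.toCompletion hφ y) < ε := by
    intro ε hε
    obtain ⟨t, ht, h⟩ := (Metric.cauchy_iff.1 hcau).2 ε hε
    exact ⟨_, ht, fun x hx y hy => h _ hx _ hy⟩
  -- One point with `bdist x ≤ M` suffices: points closer to it than φ(M + 1) for d_φ are at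
  -- distance less than 1 from it for d.
  have hev : ∀ᶠ x in l, bdist x ≤ M + 1 := by
    have hMpos : 0 < M + 1 := by
      obtain ⟨x, hx⟩ := hM.exists
      linarith [hU.bdist_pos x]
    obtain ⟨t, ht, h⟩ := hsmall (φ (M + 1)) (hφ.pos _ hMpos)
    obtain ⟨x, hxM, hxt⟩ := (hM.and_eventually ht).exists
    filter_upwards [ht] with y hy
    have h1 := (hU.mul_min_dist_le hφ hxM y).trans_lt (h x hxt y hy)
    have h2 : min (dist x y) 1 < 1 := by
      by_contra! hcon
      have := mul_le_mul_of_nonneg_left hcon (hφ.pos _ hMpos).le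
      linarith
    have h3 : dist x y < 1 := (min_lt_iff.1 h2).resolve_right (lt_irrefl _)
    have h4 := bdist_le_add_dist y x
    rw [dist_comm] at h4
    linarith
  have hMpos : 0 < M + 1 + 1 := by
    obtain ⟨x, hx⟩ := hM.exists
    linarith [hU.bdist_pos x]
  have hcau' : Cauchy (map ((↑) : X → UniformSpace.Completion X) l) := by
    refine Metric.cauchy_iff.2 ⟨inferInstance, fun ε hε => ?_⟩
    have hφ0 := hφ.pos _ hMpos
    obtain ⟨t, ht, h⟩ := hsmall (φ (M + 1 + 1) * min ε 1)
      (mul_pos hφ0 (lt_min hε one_pos))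
    refine ⟨_, image_mem_map (inter_mem ht hev), ?_⟩
    rintro _ ⟨x, hx, rfl⟩ _ ⟨y, hy, rfl⟩
    rw [UniformSpace.Completion.dist_eq]
    have h1 := (hU.mul_min_dist_le hφ hx.2 y).trans_lt (h x hx.1 y hy.1)
    have h2 := lt_of_mul_lt_mul_left h1 hφ0.le
    rcases min_lt_iff.1 h2 with h | h
    · exact h.trans_le (min_le_left _ _)
    · exact absurd (h.trans_le (min_le_right _ _)) (lt_irrefl _)
  obtain ⟨q, hq⟩ := CompleteSpace.complete hcau'
  refine ⟨q, tendsto_nhds_unique ?_ hlp⟩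
  have := ((hU.lipschitzWith_closureMap hφ).continuous.tendsto q).comp hq
  refine (tendsto_map'_iff.1 this).congr fun x => hU.closureMap_coe hφ x

/-- Limit of `mul_min_dist_le` with M = 1, in both variables. It prevents the extension from merging
boundary points or bringing distant points close to them. -/
theorem mul_min_dist_le_closureMap {ζ : UniformSpace.Completion X} (hζ : ζ ∈ boundary X)
    (q : UniformSpace.Completion X) :
    φ 2 * min (dist q ζ) 1 ≤ dist (closureMap hU.rectifiablyConnected hφ q)
      (closureMap hU.rectifiablyConnected hφ ζ) := by
  have hcont := (hU.lipschitzWith_closureMap hφ).continuous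
  have key : ∀ y : X, bdist y ≤ 1 → φ 2 * min (dist q y) 1 ≤
      dist (closureMap hU.rectifiablyConnected hφ q)
        (closureMap hU.rectifiablyConnected hφ y) := by
    intro y hy
    induction q using UniformSpace.Completion.induction_on with
    | hp =>
      refine isClosed_le ?_ (hcont.dist continuous_const)
      exact continuous_const.mul ((continuous_id.dist continuous_const).min continuous_const)
    | ih x =>
      rw [hU.closureMap_coe hφ, hU.closureMap_coe hφ, UniformSpace.Completion.dist_eq, dist_comm x, dist_comm
        (hU.toCompletion hφ x)]
      have := hU.mul_min_dist_le hφ hy x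
      norm_num at this
      exact this
  have hne : (comap ((↑) : X → UniformSpace.Completion X) (𝓝 ζ)).NeBot :=
    UniformSpace.Completion.isDenseInducing_coe.comap_nhds_neBot ζ
  have hlim : Tendsto ((↑) : X → UniformSpace.Completion X) (comap (↑) (𝓝 ζ)) (𝓝 ζ) :=
    tendsto_comap
  refine le_of_tendsto_of_tendsto
    (((tendsto_const_nhds.dist hlim).min tendsto_const_nhds).const_mul _)
    (tendsto_const_nhds.dist ((hcont.tendsto ζ).comp hlim)) ?_
  filter_upwards [hlim (Metric.ball_mem_nhds ζ one_pos)] with y hy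
  exact key y ((Metric.infDist_le_dist_of_mem hζ).trans (Metric.mem_ball.1 hy).le)

end IsUniformDomain

end DampedMetric

/-! ### The completion of a dense subset of a complete space -/

section DenseSubset

variable {Z : Type u} [MetricSpace Z] [CompleteSpace Z] {Y : Set Z}

/-- The completion of a dense subset of a complete metric space is that space. -/
noncomputable def completionEquiv (hY : Dense Y) : UniformSpace.Completion Y ≃ᵢ Z where
  toEquiv := Equiv.ofBijective (UniformSpace.Completion.extension ((↑) : Y → Z)) <| by
    have hi : Isometry (UniformSpace.Completion.extension ((↑) : Y → Z)) :=
      isometry_subtype_coe.completion_extension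
    refine ⟨hi.injective, range_eq_univ.1 ?_⟩
    rw [← hi.isClosedEmbedding.isClosed_range.closure_eq]
    refine (hY.mono fun z hz => ?_).closure_eq
    exact ⟨((⟨z, hz⟩ : Y) : UniformSpace.Completion Y),
      UniformSpace.Completion.extension_coe isometry_subtype_coe.uniformContinuous _⟩
  isometry_toFun := isometry_subtype_coe.completion_extension

@[simp]
theorem completionEquiv_coe (hY : Dense Y) (y : Y) :
    completionEquiv hY (y : UniformSpace.Completion Y) = y :=
  UniformSpace.Completion.extension_coe isometry_subtype_coe.uniformContinuous _

theorem mem_boundary_iff (hY : Dense Y) {b : UniformSpace.Completion Y} :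
    b ∈ boundary Y ↔ completionEquiv hY b ∉ Y := by
  refine not_congr ⟨?_, fun h => ⟨⟨_, h⟩, ?_⟩⟩
  · rintro ⟨y, rfl⟩
    rw [completionEquiv_coe]
    exact y.2
  · exact (completionEquiv hY).injective (completionEquiv_coe hY _)

theorem isOpen_range_coe (hY : Dense Y) (ho : IsOpen Y) :
    IsOpen (range ((↑) : Y → UniformSpace.Completion Y)) := by
  have : range ((↑) : Y → UniformSpace.Completion Y) = completionEquiv hY ⁻¹' Y := by
    ext b
    exact not_iff_not.1 (mem_boundary_iff hY)
  rw [this]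
  exact ho.preimage (completionEquiv hY).continuous

end DenseSubset

/-! ### The damped domain -/

namespace IsUniformDomain

variable {X : Type u} [MetricSpace X] {CU C : ℝ} {φ : ℝ → ℝ}
variable (hU : IsUniformDomain CU X) (hφ : IsWeight C φ)

theorem height_toCompletion_pos (x : X) : 0 < hU.height hφ (hU.toCompletion hφ x) := by
  rw [height_toCompletion]
  exact hφ.primitive_pos (hU.bdist_pos x)

theorem height_infinity_pos (hub : ¬ BoundedSpace X) :
    0 < hU.height hφ (hU.infinity hφ hub) := by
  rw [height_infinity]
  have := hφ.primitive_lt_integral le_rfl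
  rwa [primitive_zero] at this

theorem mem_dampedDomain_of_height_pos {p : DampedCompletion hU.rectifiablyConnected hφ}
    (hp : 0 < hU.height hφ p) : p ∈ dampedDomain hU.rectifiablyConnected hφ := by
  rintro ⟨ζ, hζ, rfl⟩
  exact hp.ne' (hU.height_closureMap hφ hζ)

/-- The height is positive on `X` and at infinity, and zero at the removed points; the damped domain
is therefore open. -/
theorem mem_dampedDomain_iff (hub : ¬ BoundedSpace X)
    {p : DampedCompletion hU.rectifiablyConnected hφ} :
    p ∈ dampedDomain hU.rectifiablyConnected hφ ↔ 0 < hU.height hφ p := by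
  refine ⟨fun hp => ?_, hU.mem_dampedDomain_of_height_pos hφ⟩
  rcases hU.eq_infinity_or_mem_range hφ hub p with rfl | ⟨q, rfl⟩
  · exact hU.height_infinity_pos hφ hub
  · by_cases hq : q ∈ boundary X
    · exact absurd ⟨q, hq, rfl⟩ hp
    · obtain ⟨x, rfl⟩ := not_not.1 hq
      rw [hU.closureMap_coe hφ]
      exact hU.height_toCompletion_pos hφ x

theorem isOpen_dampedDomain (hub : ¬ BoundedSpace X) :
    IsOpen (dampedDomain hU.rectifiablyConnected hφ) := by
  have : dampedDomain hU.rectifiablyConnected hφ = hU.height hφ ⁻¹' Ioi 0 :=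
    ext fun p => hU.mem_dampedDomain_iff hφ hub
  rw [this]
  exact isOpen_Ioi.preimage (hU.continuous_height hφ)

/-- The inclusion of `X` into the damped domain. -/
noncomputable def toDomain (x : X) : dampedDomain hU.rectifiablyConnected hφ :=
  ⟨hU.toCompletion hφ x, hU.mem_dampedDomain_of_height_pos hφ (hU.height_toCompletion_pos hφ x)⟩

/-- The point at infinity of the damped domain. -/
noncomputable def infty (hub : ¬ BoundedSpace X) : dampedDomain hU.rectifiablyConnected hφ :=
  ⟨hU.infinity hφ hub, hU.mem_dampedDomain_of_height_pos hφ (hU.height_infinity_pos hφ hub)⟩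

theorem dist_toDomain (x y : X) : dist (hU.toDomain hφ x) (hU.toDomain hφ y) =
    dist (hU.toCompletion hφ x) (hU.toCompletion hφ y) := rfl

theorem edist_toDomain (x y : X) : edist (hU.toDomain hφ x) (hU.toDomain hφ y) =
    dampedEDist φ x y := hU.edist_toCompletion hφ x y

theorem lipschitzWith_toDomain : LipschitzWith (Real.toNNReal CU) (hU.toDomain hφ) :=
  LipschitzWith.of_dist_le' (hU.dist_toCompletion_le_mul hφ)

theorem tendsto_infty (hub : ¬ BoundedSpace X) :
    Tendsto (hU.toDomain hφ) (comap bdist atTop) (𝓝 (hU.infty hφ hub)) :=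
  tendsto_subtype_rng.2 (hU.tendsto_infinity hφ hub)

theorem range_toDomain (hub : ¬ BoundedSpace X) :
    range (hU.toDomain hφ) = {hU.infty hφ hub}ᶜ := by
  ext p
  constructor
  · rintro ⟨x, rfl⟩ h
    have := congrArg (fun p => hU.height hφ p.1) (mem_singleton_iff.1 h)
    simp only [toDomain, infty, height_toCompletion, height_infinity] at this
    exact (hφ.primitive_lt_integral (bdist_nonneg x)).ne this
  · intro h
    rcases hU.eq_infinity_or_mem_range hφ hub p.1 with hp | ⟨q, hq⟩
    · exact absurd (Subtype.ext hp) h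
    · by_cases hqb : q ∈ boundary X
      · exact absurd ⟨q, hqb, hq⟩ p.2
      · obtain ⟨x, rfl⟩ := not_not.1 hqb
        rw [hU.closureMap_coe hφ] at hq
        exact ⟨x, Subtype.ext hq⟩

/-! ### Embedding, local bi-Lipschitz bounds, isometry near the boundary. -/

theorem dist_le_of_dist_le_one {M : ℝ} {x y : X} (hM : bdist x ≤ M) (hxy : dist x y ≤ 1) :
    dist x y ≤ (φ (M + 1))⁻¹ * dist (hU.toDomain hφ x) (hU.toDomain hφ y) := by
  have h := hU.mul_min_dist_le hφ hM y
  rw [min_eq_left hxy] at h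
  have : 0 < φ (M + 1) := hφ.pos _ (by linarith [hU.bdist_pos x])
  rwa [le_inv_mul_iff₀ this]

theorem biLipschitzOn_toDomain {M : ℝ} {s : Set X} (hs : ∀ x ∈ s, bdist x ≤ M)
    (hd : ∀ x ∈ s, ∀ y ∈ s, dist x y ≤ 1) :
    1 ≤ max CU (φ (M + 1))⁻¹ ∧ BiLipschitzOn (max CU (φ (M + 1))⁻¹) (hU.toDomain hφ) s := by
  refine ⟨le_max_of_le_left hU.one_le, fun x hx y hy => ⟨?_, ?_⟩⟩
  · exact (hU.dist_le_of_dist_le_one hφ (hs x hx) (hd x hx y hy)).trans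
      (mul_le_mul_of_nonneg_right (le_max_right _ _) dist_nonneg)
  · exact (hU.dist_toCompletion_le_mul hφ x y).trans
      (mul_le_mul_of_nonneg_right (le_max_left _ _) dist_nonneg)

theorem locallyBiLipschitz_toDomain : LocallyBiLipschitz (hU.toDomain hφ) := by
  intro x
  refine ⟨_, Metric.ball_mem_nhds x one_half_pos, _,
    hU.biLipschitzOn_toDomain hφ (M := bdist x + 1) (fun y hy => ?_) fun y hy z hz => ?_⟩
  · have := bdist_le_add_dist y x
    have := Metric.mem_ball.1 hy
    linarith
  · have := dist_triangle_right y z x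
    have := Metric.mem_ball.1 hy
    have := Metric.mem_ball.1 hz
    linarith

theorem isEmbedding_toDomain : IsEmbedding (hU.toDomain hφ) := by
  have hi : IsInducing (hU.toDomain hφ) := by
    refine isInducing_iff_nhds.2 fun x => le_antisymm
      ((hU.lipschitzWith_toDomain hφ).continuous.tendsto x).le_comap ?_
    have h2 := hφ.pos (bdist x + 1) (by linarith [hU.bdist_pos x])
    refine Metric.nhds_basis_ball.ge_iff.2 fun ε hε => ?_
    refine mem_of_superset (preimage_mem_comap
      (Metric.ball_mem_nhds _ (mul_pos h2 (lt_min hε one_pos)))) fun y hy => ?_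
    rw [mem_preimage, Metric.mem_ball'] at hy
    rw [Metric.mem_ball']
    have h := lt_of_mul_lt_mul_left ((hU.mul_min_dist_le hφ le_rfl y).trans_lt hy) h2.le
    rcases min_lt_iff.1 h with h | h
    · exact h.trans_le (min_le_left _ _)
    · exact absurd (h.trans_le (min_le_right _ _)) (lt_irrefl _)
  exact hi.isEmbedding

theorem bdist_lt_of_mem_boundaryBall {ζ : boundary X} {r : ℝ} {x : X} (hx : x ∈ boundaryBall ζ r) :
    bdist x < r :=
  (Metric.infDist_le_dist_of_mem ζ.2).trans_lt hx

theorem dist_lt_of_mem_boundaryBall {ζ : boundary X} {r : ℝ} {x y : X}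
    (hx : x ∈ boundaryBall ζ r) (hy : y ∈ boundaryBall ζ r) : dist x y < r + r := by
  rw [← UniformSpace.Completion.dist_eq]
  exact (dist_triangle_right _ _ (ζ : UniformSpace.Completion X)).trans_lt (add_lt_add hx hy)

theorem uniformlyLocallyBiLipschitzNearBoundary_toDomain :
    UniformlyLocallyBiLipschitzNearBoundary (hU.toDomain hφ) := by
  refine ⟨1 / 2, by norm_num, max CU (φ (1 + 1))⁻¹, le_max_of_le_left hU.one_le, fun ζ => ?_⟩
  refine (hU.biLipschitzOn_toDomain hφ (fun x hx => ?_) fun x hx y hy => ?_).2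
  · linarith [bdist_lt_of_mem_boundaryBall hx]
  · linarith [dist_lt_of_mem_boundaryBall hx hy]

theorem locallyIsometricNearBoundary_toDomain (hl : IsLengthSpace X) :
    LocallyIsometricNearBoundary (hU.toDomain hφ) := by
  -- With this radius `bdist x + dist x y < 1 / 4 + 1 / 2`, inside the range where φ = 1.
  refine ⟨1 / 4, by norm_num, fun ζ x hx y hy => le_antisymm ?_ ?_⟩
  · rw [dist_toDomain, hU.dist_toCompletion_le_iff hφ dist_nonneg, ← edist_dist, hl x y]
    refine le_iInf fun γ => le_iInf fun hγ => ?_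
    by_cases hfin : eVariationOn γ (Icc 0 1) = ⊤
    · exact hfin ▸ le_top
    · obtain ⟨L, δ, h, hL, -⟩ := hγ.exists_arcLength hfin
      exact hL ▸ dampedEDist_le_length hφ hU.bdist_pos h
  · have h1 := bdist_lt_of_mem_boundaryBall hx
    have h2 := dist_lt_of_mem_boundaryBall hx hy
    have h3 := hφ.mul_le_primitive_sub (M := 1) (bdist_nonneg x) (dist_nonneg (x := x) (y := y))
      (by linarith) one_pos
    rw [hφ.eq_one 1 one_pos le_rfl, one_mul] at h3
    exact h3.trans (hU.primitive_sub_le_dist hφ x y)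

/-! ### The boundary of the damped domain -/

theorem dense_dampedDomain : Dense (dampedDomain hU.rectifiablyConnected hφ) :=
  (hU.denseRange_toCompletion hφ).mono <| range_subset_iff.2 fun x => (hU.toDomain hφ x).2

/-- Stated on the whole completion, so that it yields both the homeomorphism of the boundaries and
the criterion for sequences in `X`. -/
theorem comap_closureMap_nhds {ζ : UniformSpace.Completion X} (hζ : ζ ∈ boundary X) :
    comap (closureMap hU.rectifiablyConnected hφ)
      (𝓝 (closureMap hU.rectifiablyConnected hφ ζ)) = 𝓝 ζ := by
  refine le_antisymm ?_ ((hU.lipschitzWith_closureMap hφ).continuous.tendsto ζ).le_comap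
  have h2 := hφ.pos 2 two_pos
  refine Metric.nhds_basis_ball.ge_iff.2 fun ε hε => ?_
  refine mem_of_superset (preimage_mem_comap
    (Metric.ball_mem_nhds _ (mul_pos h2 (lt_min hε one_pos)))) fun q hq => ?_
  have h := lt_of_mul_lt_mul_left ((hU.mul_min_dist_le_closureMap hφ hζ q).trans_lt hq) h2.le
  rcases min_lt_iff.1 h with h | h
  · exact h.trans_le (min_le_left _ _)
  · exact absurd (h.trans_le (min_le_right _ _)) (lt_irrefl _)

/-- The restriction of `closureMap`, read through the identification of the completion of the damped
domain with the damped completion. It is onto because the points removed are exactly the images of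
boundary points. -/
theorem exists_boundary_homeomorph :
    ∃ e : boundary X ≃ₜ boundary (dampedDomain hU.rectifiablyConnected hφ),
      ∀ ζ, completionEquiv (hU.dense_dampedDomain hφ) (e ζ) =
        closureMap hU.rectifiablyConnected hφ ζ := by
  set Ψ := completionEquiv (hU.dense_dampedDomain hφ)
  have hmem : ∀ ζ : boundary X, Ψ.symm (closureMap hU.rectifiablyConnected hφ ζ) ∈
      boundary (dampedDomain hU.rectifiablyConnected hφ) := fun ζ => by
    rw [mem_boundary_iff (hU.dense_dampedDomain hφ), Ψ.apply_symm_apply]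
    exact not_not.2 ⟨ζ, ζ.2, rfl⟩
  let f : boundary X → boundary (dampedDomain hU.rectifiablyConnected hφ) := fun ζ => ⟨_, hmem ζ⟩
  have hind : IsInducing f := by
    refine (Ψ.toHomeomorph.isInducing.comp IsInducing.subtypeVal).of_comp_iff.1 ?_
    have : (Ψ.toHomeomorph ∘ Subtype.val) ∘ f =
        closureMap hU.rectifiablyConnected hφ ∘ Subtype.val := funext fun ζ => Ψ.apply_symm_apply _
    rw [this]
    refine isInducing_iff_nhds.2 fun ζ => ?_
    rw [nhds_subtype, ← hU.comap_closureMap_nhds hφ ζ.2, comap_comap]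
    rfl
  have hbij : Function.Bijective f := by
    refine ⟨hind.injective, fun b => ?_⟩
    obtain ⟨ζ, hζ, h⟩ := not_not.1 ((mem_boundary_iff (hU.dense_dampedDomain hφ)).1 b.2)
    exact ⟨⟨ζ, hζ⟩, Subtype.ext (Ψ.symm_apply_eq.2 h)⟩
  exact ⟨(Equiv.ofBijective f hbij).toHomeomorphOfIsInducing hind, fun ζ => Ψ.apply_symm_apply _⟩

theorem tendsto_boundary_iff
    (e : boundary X ≃ₜ boundary (dampedDomain hU.rectifiablyConnected hφ))
    (he : ∀ ζ, completionEquiv (hU.dense_dampedDomain hφ) (e ζ) =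
      closureMap hU.rectifiablyConnected hφ ζ) (ζ : boundary X) (u : ℕ → X) :
    Tendsto (fun n => (u n : UniformSpace.Completion X)) atTop (𝓝 ζ) ↔
      Tendsto (fun n => (hU.toDomain hφ (u n) : UniformSpace.Completion
        (dampedDomain hU.rectifiablyConnected hφ))) atTop (𝓝 (e ζ)) := by
  rw [← hU.comap_closureMap_nhds hφ ζ.2, tendsto_comap_iff, ← he ζ,
    (completionEquiv (hU.dense_dampedDomain hφ)).toHomeomorph.isInducing.tendsto_nhds_iff]
  have h : closureMap hU.rectifiablyConnected hφ ∘ (fun n => (u n : UniformSpace.Completion X)) =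
      completionEquiv (hU.dense_dampedDomain hφ) ∘ fun n => (hU.toDomain hφ (u n) :
        UniformSpace.Completion (dampedDomain hU.rectifiablyConnected hφ)) := by
    funext n
    rw [Function.comp_apply, Function.comp_apply, completionEquiv_coe, hU.closureMap_coe hφ]
    rfl
  rw [h]
  rfl

/-- The height is 1-Lipschitz and is not positive at any boundary point of the damped domain. -/
theorem height_le_bdist (hub : ¬ BoundedSpace X)
    (p : dampedDomain hU.rectifiablyConnected hφ) : hU.height hφ p ≤ bdist p := by
  obtain ⟨e, -⟩ := hU.exists_boundary_homeomorph hφ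
  obtain ⟨ζ, hζ⟩ := boundary_nonempty hU.not_complete
  refine (Metric.le_infDist ⟨_, (e ⟨ζ, hζ⟩).2⟩).2 fun b hb => ?_
  rw [← (completionEquiv (hU.dense_dampedDomain hφ)).dist_eq, completionEquiv_coe]
  have h := hU.height_sub_le_dist hφ p (completionEquiv (hU.dense_dampedDomain hφ) b)
  rw [mem_boundary_iff (hU.dense_dampedDomain hφ), hU.mem_dampedDomain_iff hφ hub, not_lt] at hb
  linarith

end IsUniformDomain

/-! ### Uniform curves in the damped domain -/

section Curves

variable {X : Type u} [MetricSpace X]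

theorem continuousOn_of_dist_le {γ : ℝ → X} {s : Set ℝ}
    (h : ∀ u ∈ s, ∀ v ∈ s, u ≤ v → dist (γ u) (γ v) ≤ v - u) : ContinuousOn γ s := by
  have : LipschitzOnWith 1 γ s := LipschitzOnWith.of_dist_le_mul fun u hu v hv => by
    rw [NNReal.coe_one, one_mul]
    rcases le_total u v with huv | huv
    · rw [dist_comm u, Real.dist_eq, abs_of_nonneg (sub_nonneg.2 huv)]
      exact h u hu v hv huv
    · rw [dist_comm, Real.dist_eq, abs_of_nonneg (sub_nonneg.2 huv)]
      exact h v hv u hu huv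
  exact this.continuousOn

end Curves

/-- The uniformity constant of the damped domain. -/
noncomputable def dampedConstant (C CU : ℝ) : ℝ :=
  2 * rayConstant CU * C ^ doublingExponent (rayConstant CU)

namespace IsUniformDomain

variable {X : Type u} [MetricSpace X] {CU C : ℝ} {φ : ℝ → ℝ}
variable (hU : IsUniformDomain CU X) (hφ : IsWeight C φ)

theorem rayConstant_le_dampedConstant (hU : IsUniformDomain CU X) (hφ : IsWeight C φ) :
    rayConstant CU ≤ dampedConstant C CU := by
  have h1 := hU.one_le
  have h2 := hU.le_rayConstant
  have h3 : 1 ≤ C ^ doublingExponent (rayConstant CU) := one_le_pow₀ hφ.one_le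
  unfold dampedConstant
  nlinarith

/-- Increments for d_φ are bounded by the measure of density φ(bdist ∘ γ), hence so is the
variation. -/
theorem eVariationOn_toDomain_le {L : ℝ} {γ : ℝ → X} {x y : X} (h : IsArcLengthCurve L γ x y)
    {t : ℝ} (ht : t ∈ Icc (0 : ℝ) 1) :
    eVariationOn (fun t => hU.toDomain hφ (γ (L * t))) (Icc 0 t) ≤
      ∫⁻ s in Ico 0 (L * t), ENNReal.ofReal (φ (bdist (γ s))) := by
  have h1 := eVariationOn.comp_eq_of_monotoneOn (fun s => hU.toDomain hφ (γ s)) (t := Icc 0 t)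
    (fun s => L * s) (fun s _ t _ hst => mul_le_mul_of_nonneg_left hst h.nonneg)
  rw [image_mul_left_Icc h.nonneg ht.1, mul_zero] at h1
  refine h1.trans_le ?_
  rw [← withDensity_apply _ measurableSet_Ico]
  refine eVariationOn_le_measure fun u v hu huv hv => ?_
  rw [withDensity_apply _ measurableSet_Ico, edist_toDomain]
  exact h.dampedEDist_le_lintegral φ hu huv (hv.trans (mul_le_of_le_one_right h.nonneg ht.2))

theorem eVariationOn_toDomain_le_bdist (hub : ¬ BoundedSpace X) {L : ℝ} {γ : ℝ → X} {x y : X}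
    (h : IsArcLengthCurve L γ x y) (hQ : IsCigarFrom (rayConstant CU) (L / 2) γ) {t : ℝ}
    (ht : t ∈ Icc (0 : ℝ) (1 / 2)) :
    eVariationOn (fun t => hU.toDomain hφ (γ (L * t))) (Icc 0 t) ≤
      ENNReal.ofReal (dampedConstant C CU * bdist (hU.toDomain hφ (γ (L * t)))) := by
  have hL := h.nonneg
  refine (hU.eVariationOn_toDomain_le hφ h ⟨ht.1, ht.2.trans (by norm_num)⟩).trans ?_
  refine ((hQ.initial (by nlinarith [ht.2])).lintegral_le_primitive hφ hU.bdist_pos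
    (mul_nonneg hL ht.1)).trans (ENNReal.ofReal_le_ofReal ?_)
  rw [← hU.height_toCompletion hφ]
  have h1 := hU.height_nonneg hφ (hU.toCompletion hφ (γ (L * t)))
  exact mul_le_mul (hU.rayConstant_le_dampedConstant hφ) (hU.height_le_bdist hφ hub
    (hU.toDomain hφ _)) h1
    (hQ.pos.le.trans (hU.rayConstant_le_dampedConstant hφ))

theorem eVariationOn_toDomain_half_le {L : ℝ} {γ : ℝ → X} {x y : X} (h : IsArcLengthCurve L γ x y)
    (hL : L ≤ CU * dist x y) (hQ : IsCigarFrom (rayConstant CU) (L / 2) γ) :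
    eVariationOn (fun t => hU.toDomain hφ (γ (L * t))) (Icc 0 (1 / 2)) ≤
      ENNReal.ofReal (dampedConstant C CU / 2 * dist (hU.toDomain hφ x) (hU.toDomain hφ y)) := by
  have hL0 := h.nonneg
  have hC : 0 ≤ C ^ doublingExponent (rayConstant CU) :=
    pow_nonneg (zero_le_one.trans hφ.one_le) _
  have hx := bdist_nonneg x
  refine (hU.eVariationOn_toDomain_le hφ h ⟨by norm_num, by norm_num⟩).trans ?_
  rw [mul_one_div]
  refine (hQ.lintegral_le hφ hU.bdist_pos
    (h.initial (by linarith) (by linarith))).trans (ENNReal.ofReal_le_ofReal ?_)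
  -- Each half of the curve may use half of the constant; this explains the factor 2 in
  -- `dampedConstant`.
  have h0 : dampedConstant C CU / 2 = C ^ doublingExponent (rayConstant CU) * rayConstant CU := by
    unfold dampedConstant
    ring
  rw [h0, mul_assoc]
  refine mul_le_mul_of_nonneg_left ?_ hC
  -- Concavity removes the factor CU from the argument, and the lower estimate for d_φ then applies.
  calc primitive φ (bdist x + L / 2) - primitive φ (bdist x)
      ≤ primitive φ (bdist x + CU * dist x y) - primitive φ (bdist x) :=
        sub_le_sub_right (hφ.primitive_le (by linarith) (by linarith)) _
    _ ≤ CU * (primitive φ (bdist x + dist x y) - primitive φ (bdist x)) :=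
        hφ.primitive_add_mul_sub_le hx dist_nonneg hU.one_le
    _ ≤ rayConstant CU * dist (hU.toDomain hφ x) (hU.toDomain hφ y) :=
        mul_le_mul hU.le_rayConstant (hU.primitive_sub_le_dist hφ x y)
          (sub_nonneg.2 (hφ.primitive_le hx (by linarith [dist_nonneg (x := x) (y := y)])))
          hQ.pos.le

/-- The uniform curve for d works unchanged; the estimates for its second half are those for the
first half of the reversed curve. -/
theorem exists_isUniformCurve_toDomain (hub : ¬ BoundedSpace X) (x y : X) :
    ∃ f, IsUniformCurve (dampedConstant C CU) f (hU.toDomain hφ x) (hU.toDomain hφ y) := by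
  obtain ⟨L, γ, h, hL, hQ1, hQ2⟩ := hU.exists_cigars x y
  have hL0 := h.nonneg
  have hA : 0 ≤ dampedConstant C CU / 2 := by
    linarith [hQ1.pos.le.trans (hU.rayConstant_le_dampedConstant hφ)]
  set f : ℝ → dampedDomain hU.rectifiablyConnected hφ := fun t => hU.toDomain hφ (γ (L * t))
  have hrev : ∀ t, eVariationOn (fun t => hU.toDomain hφ (γ (L - L * t))) (Icc 0 t) =
      eVariationOn f (Icc (1 - t) 1) := by
    intro t
    have := eVariationOn_comp_const_sub f 1 0 t
    rw [sub_zero] at this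
    rw [← this]
    simp only [f, mul_sub, mul_one]
  refine ⟨f, ⟨?_, ?_, ?_⟩, ?_, fun t ht => ?_⟩
  · refine (hU.lipschitzWith_toDomain hφ).continuous.comp_continuousOn ?_
    refine (continuousOn_of_dist_le (s := Icc 0 L) fun u hu v hv huv =>
      h.dist_le hu.1 huv hv.2).comp (by fun_prop) fun t ht => ?_
    exact ⟨mul_nonneg hL0 ht.1, mul_le_of_le_one_right hL0 ht.2⟩
  · simp only [f, mul_zero, h.source]
  · simp only [f, mul_one, h.target]
  · have e := eVariationOn.Icc_add_Icc f (s := univ) (a := 0) (b := 1 / 2) (c := 1) (by norm_num)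
      (by norm_num) (mem_univ _)
    simp only [univ_inter] at e
    have h1 := hU.eVariationOn_toDomain_half_le hφ h hL hQ1
    have h2 := hU.eVariationOn_toDomain_half_le hφ h.reverse (dist_comm x y ▸ hL) hQ2
    rw [hrev, sub_half, dist_comm] at h2
    rw [← e]
    refine (add_le_add h1 h2).trans ?_
    rw [← ENNReal.ofReal_add (mul_nonneg hA dist_nonneg) (mul_nonneg hA dist_nonneg)]
    refine (congrArg _ ?_).le
    ring
  · rcases le_total t (1 / 2) with h2 | h2
    · exact min_le_of_left_le (hU.eVariationOn_toDomain_le_bdist hφ hub h hQ1 ⟨ht.1, h2⟩)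
    · refine min_le_of_right_le ?_
      have := hU.eVariationOn_toDomain_le_bdist hφ hub h.reverse hQ2 (t := 1 - t)
        ⟨by linarith [ht.2], by linarith⟩
      rw [hrev, sub_sub_cancel] at this
      have e : L - L * (1 - t) = L * t := by ring
      rwa [e] at this

/-! ### Uniform curves to infinity -/

theorem tendsto_div_one_sub_atTop : Tendsto (fun t : ℝ => t / (1 - t)) (𝓝[<] 1) atTop := by
  have h1 : Tendsto (fun t : ℝ => 1 - t) (𝓝[<] 1) (𝓝[>] 0) := by
    refine tendsto_nhdsWithin_iff.2 ⟨?_, ?_⟩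
    · have : Tendsto (fun t : ℝ => 1 - t) (𝓝 1) (𝓝 (1 - 1)) := by
        exact (continuous_const.sub continuous_id).tendsto 1
      rw [sub_self] at this
      exact this.mono_left nhdsWithin_le_nhds
    · filter_upwards [self_mem_nhdsWithin] with t ht
      exact mem_Ioi.2 (sub_pos.2 ht)
  have h2 : Tendsto (fun t : ℝ => t) (𝓝[<] 1) (𝓝 1) := tendsto_id.mono_left nhdsWithin_le_nhds
  exact h2.pos_mul_atTop one_pos (tendsto_inv_nhdsGT_zero.comp h1)

/-- A ray from x, run through in time [0,1) and closed up by the point at infinity. The piece from x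
always satisfies the cigar condition, except at time 1, where the other piece is a single point. -/
theorem exists_isUniformCurve_infty (hub : ¬ BoundedSpace X) (x : X) :
    ∃ f, IsUniformCurve (dampedConstant C CU) f (hU.toDomain hφ x) (hU.infty hφ hub) := by
  obtain ⟨γ, hγ⟩ := hU.exists_ray hub x
  have hQ : ∀ S, 0 ≤ S → IsCigarFrom (rayConstant CU) S γ := fun S hS => (hγ S hS).2
  have hpos := (hQ 0 le_rfl).pos
  have hKA : C ^ doublingExponent (rayConstant CU) ≤ dampedConstant C CU := by
    have h1 := hU.one_le.trans hU.le_rayConstant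
    have h2 : 0 ≤ C ^ doublingExponent (rayConstant CU) :=
      pow_nonneg (zero_le_one.trans hφ.one_le) _
    unfold dampedConstant
    nlinarith
  have hK0 : 0 ≤ C ^ doublingExponent (rayConstant CU) :=
    pow_nonneg (zero_le_one.trans hφ.one_le) _
  have hA := hpos.le.trans (hU.rayConstant_le_dampedConstant hφ)
  set w : ℝ → ℝ≥0∞ := fun s => ENNReal.ofReal (φ (bdist (γ s)))
  set f : ℝ → dampedDomain hU.rectifiablyConnected hφ :=
    fun t => if t < 1 then hU.toDomain hφ (γ (t / (1 - t))) else hU.infty hφ hub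
  have hf : ∀ t : ℝ, t < 1 → f t = hU.toDomain hφ (γ (t / (1 - t))) := fun t ht => if_pos ht
  have hf1 : f 1 = hU.infty hφ hub := if_neg (lt_irrefl 1)
  have hdiv : ∀ t : ℝ, 0 ≤ t → t < 1 → 0 ≤ t / (1 - t) := fun t h0 h1 =>
    div_nonneg h0 (sub_nonneg.2 h1.le)
  have hlim : Tendsto f (𝓝[<] 1) (𝓝 (f 1)) := by
    rw [hf1]
    have hb : Tendsto (fun t : ℝ => bdist (γ (t / (1 - t)))) (𝓝[<] 1) atTop := by
      refine tendsto_atTop_mono' _ ?_ (tendsto_div_one_sub_atTop.atTop_div_const hpos)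
      have h0 : ∀ᶠ t : ℝ in 𝓝[<] 1, 0 < t :=
        nhdsWithin_le_nhds (Ioi_mem_nhds one_pos)
      filter_upwards [self_mem_nhdsWithin, h0] with t ht h0
      rw [div_le_iff₀' hpos]
      exact (hQ _ (hdiv t h0.le ht)).le_bdist _ ⟨hdiv t h0.le ht, le_rfl⟩
    refine ((hU.tendsto_infty hφ hub).comp (tendsto_comap_iff.2 hb)).congr' ?_
    filter_upwards [self_mem_nhdsWithin] with t ht
    exact (hf t ht).symm
  have hcont : ContinuousOn f (Icc 0 1) := by
    have hγc : ContinuousOn γ (Ici 0) := continuousOn_of_dist_le fun u hu v hv huv =>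
      (hγ v hv).1.dist_le hu huv le_rfl
    intro t ht
    rcases ht.2.lt_or_eq with h1 | rfl
    · have h2 : ContinuousOn f (Ico 0 1) := by
        refine ContinuousOn.congr ?_ fun s hs => hf s hs.2
        refine (hU.lipschitzWith_toDomain hφ).continuous.comp_continuousOn ?_
        refine hγc.comp (continuousOn_id.div (continuousOn_const.sub continuousOn_id)
          fun s hs => (sub_pos.2 hs.2).ne') fun s hs => hdiv s hs.1 hs.2
      refine (h2 t ⟨ht.1, h1⟩).mono_of_mem_nhdsWithin ?_
      filter_upwards [self_mem_nhdsWithin, nhdsWithin_le_nhds (Iio_mem_nhds h1)] with s hs hs1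
      exact ⟨hs.1, hs1⟩
    · have h2 : ContinuousWithinAt f (insert 1 (Iio 1)) 1 := continuousWithinAt_insert_self.2 hlim
      refine h2.mono fun s hs => ?_
      rcases hs.2.lt_or_eq with h | h
      · exact Or.inr h
      · exact Or.inl h
  -- The inverse of `t ↦ t / (1 - t)`; ν transports weighted arc length along the ray to the time
  -- interval.
  set ρ : ℝ → ℝ := fun s => s / (1 + s)
  have hρ : Measurable ρ := measurable_id.div (measurable_const.add measurable_id)
  set ν : Measure ℝ := ((volume.withDensity w).restrict (Ici 0)).map ρ
  have hν : ∀ u v, ν (Ico u v) = ∫⁻ s in ρ ⁻¹' Ico u v ∩ Ici 0, w s := fun u v => by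
    rw [Measure.map_apply hρ measurableSet_Ico,
      Measure.restrict_apply (hρ measurableSet_Ico),
      withDensity_apply _ ((hρ measurableSet_Ico).inter measurableSet_Ici)]
  have hinc1 : ∀ u v, 0 ≤ u → u ≤ v → v < 1 → edist (f u) (f v) ≤ ν (Ico u v) := by
    intro u v hu huv hv
    have huv' : u / (1 - u) ≤ v / (1 - v) := by
      rw [div_le_div_iff₀ (by linarith) (by linarith)]
      nlinarith
    rw [hf u (huv.trans_lt hv), hf v hv, edist_toDomain, hν]
    refine ((hγ _ (hdiv v (hu.trans huv) hv)).1.dampedEDist_le_lintegral φ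
      (hdiv u hu (huv.trans_lt hv)) huv' le_rfl).trans (lintegral_mono_set fun s hs => ?_)
    have hs0 : 0 ≤ s := (hdiv u hu (huv.trans_lt hv)).trans hs.1
    have h1 := hs.1
    have h2 := hs.2
    rw [div_le_iff₀ (by linarith)] at h1
    rw [lt_div_iff₀ (by linarith)] at h2
    refine ⟨⟨?_, ?_⟩, hs0⟩
    · rw [le_div_iff₀ (by linarith)]
      linarith
    · rw [div_lt_iff₀ (by linarith)]
      linarith
  have hinc : ∀ u v, 0 ≤ u → u ≤ v → v ≤ 1 → edist (f u) (f v) ≤ ν (Ico u v) := by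
    intro u v hu huv hv
    rcases hv.lt_or_eq with hv | rfl
    · exact hinc1 u v hu huv hv
    rcases huv.lt_or_eq with huv | rfl
    · refine le_of_tendsto (tendsto_const_nhds.edist hlim) ?_
      filter_upwards [Ioo_mem_nhdsLT huv] with t ht
      exact (hinc1 u t hu ht.1.le ht.2).trans (measure_mono (Ico_subset_Ico_right ht.2.le))
    · simp
  have hvar : ∀ t : ℝ, t ≤ 1 → eVariationOn f (Icc 0 t) ≤ ν (Ico 0 t) := fun t ht =>
    eVariationOn_le_measure fun u v hu huv hv => hinc u v hu huv (hv.trans ht)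
  refine ⟨f, ⟨hcont, ?_, hf1⟩, ?_, fun t ht => ?_⟩
  · rw [hf 0 one_pos, zero_div, (hγ 0 le_rfl).1.source]
  · have hun : ⋃ n : ℕ, Ico (0 : ℝ) n = Ici 0 := by
      ext s
      simp only [mem_iUnion, mem_Ico, mem_Ici]
      exact ⟨fun ⟨_, h⟩ => h.1, fun h => (exists_nat_gt s).imp fun _ hn => ⟨h, hn⟩⟩
    have hmono : Monotone fun n : ℕ => Ico (0 : ℝ) n := fun m n hmn =>
      Ico_subset_Ico_right (by exact_mod_cast hmn)
    have hdist := hU.height_sub_le_dist hφ (hU.infty hφ hub) (hU.toDomain hφ x)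
    have hx := bdist_nonneg x
    calc eVariationOn f (Icc 0 1) ≤ ν (Ico 0 1) := hvar 1 le_rfl
      _ ≤ ∫⁻ s in Ici 0, w s := by
        rw [hν]
        exact lintegral_mono_set inter_subset_right
      _ = ⨆ n : ℕ, ∫⁻ s in Ico 0 (n : ℝ), w s := by
        rw [← withDensity_apply _ measurableSet_Ici, ← hun, hmono.measure_iUnion]
        exact iSup_congr fun n => withDensity_apply _ measurableSet_Ico
      _ ≤ ENNReal.ofReal (C ^ doublingExponent (rayConstant CU) *
          ((∫ s in Ioi 0, φ s) - primitive φ (bdist x))) := by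
        refine iSup_le fun n => ((hQ n n.cast_nonneg).lintegral_le hφ hU.bdist_pos
          (hγ n n.cast_nonneg).1).trans (ENNReal.ofReal_le_ofReal ?_)
        exact mul_le_mul_of_nonneg_left (sub_le_sub_right
          (hφ.primitive_le_integral (add_nonneg hx n.cast_nonneg)) _) hK0
      _ ≤ _ := by
        -- The tail of the integral is the difference of the heights of infinity and x, hence at
        -- most their distance.
        refine ENNReal.ofReal_le_ofReal ?_
        change hU.height hφ (hU.infinity hφ hub) - hU.height hφ (hU.toCompletion hφ x) ≤ _ at hdist
        rw [height_infinity, height_toCompletion] at hdist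
        rw [dist_comm]
        exact mul_le_mul hKA hdist (sub_nonneg.2 (hφ.primitive_le_integral hx)) hA
  · rcases ht.2.lt_or_eq with h1 | rfl
    · refine min_le_of_left_le ((hvar t ht.2).trans ?_)
      have ht0 := hdiv t ht.1 h1
      rw [hν, hf t h1]
      calc ∫⁻ s in ρ ⁻¹' Ico 0 t ∩ Ici 0, w s ≤ ∫⁻ s in Ico 0 (t / (1 - t)), w s := by
            refine lintegral_mono_set fun s hs => ⟨hs.2, ?_⟩
            have hs0 : 0 ≤ s := hs.2
            have h2 : s / (1 + s) < t := hs.1.2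
            rw [div_lt_iff₀ (by linarith)] at h2
            rw [lt_div_iff₀ (by linarith)]
            linarith
        _ ≤ _ := (hQ _ ht0).lintegral_le_primitive hφ hU.bdist_pos ht0
        _ ≤ _ := by
            refine ENNReal.ofReal_le_ofReal ?_
            rw [← hU.height_toCompletion hφ]
            exact mul_le_mul (hU.rayConstant_le_dampedConstant hφ) (hU.height_le_bdist hφ hub
              (hU.toDomain hφ _)) (hU.height_nonneg hφ _) hA
    · refine min_le_of_right_le ?_
      rw [Icc_self, eVariationOn.subsingleton _ subsingleton_singleton]
      exact zero_le

/-! ### Uniformity of the damped domain. -/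

theorem isUniformDomain_dampedDomain (hub : ¬ BoundedSpace X) :
    IsUniformDomain (dampedConstant C CU) (dampedDomain hU.rectifiablyConnected hφ) := by
  refine ⟨?_, fun hc => ?_, ?_, fun p q hpq => ?_⟩
  · exact hU.one_le.trans (hU.le_rayConstant.trans (hU.rayConstant_le_dampedConstant hφ))
  · obtain ⟨e, -⟩ := hU.exists_boundary_homeomorph hφ
    obtain ⟨ζ, hζ⟩ := boundary_nonempty hU.not_complete
    refine (e ⟨ζ, hζ⟩).2 ?_
    have hi := UniformSpace.Completion.coe_isometry
      (α := dampedDomain hU.rectifiablyConnected hφ)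
    have hd := UniformSpace.Completion.denseRange_coe
      (α := dampedDomain hU.rectifiablyConnected hφ)
    rw [← hi.isClosedEmbedding.isClosed_range.closure_eq, hd.closure_range]
    trivial
  · exact isOpen_range_coe (hU.dense_dampedDomain hφ) (hU.isOpen_dampedDomain hφ hub)
  · have hr : ∀ p, p ≠ hU.infty hφ hub → ∃ x, hU.toDomain hφ x = p := fun p hp => by
      have : p ∈ range (hU.toDomain hφ) := hU.range_toDomain hφ hub ▸ hp
      exact this
    by_cases hp : p = hU.infty hφ hub
    · subst hp
      obtain ⟨x, rfl⟩ := hr q hpq.symm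
      obtain ⟨f, hf⟩ := hU.exists_isUniformCurve_infty hφ hub x
      exact ⟨_, hf.reverse⟩
    · obtain ⟨x, rfl⟩ := hr p hp
      by_cases hq : q = hU.infty hφ hub
      · exact hq ▸ hU.exists_isUniformCurve_infty hφ hub x
      · obtain ⟨y, rfl⟩ := hr q hq
        exact hU.exists_isUniformCurve_toDomain hφ hub x y

end IsUniformDomain

end DampedDomain

open DampedDomain in
theorem theorem1p1 :
    ∃ A : ℝ → ℝ → ℝ,
      ∀ (Ω : Type*) [MetricSpace Ω] [LocallyCompactSpace Ω] (CU Cφ : ℝ) (φ : ℝ → ℝ)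
        (hΩ : IsUniformDomain CU Ω) (_ : ¬ BoundedSpace Ω) (hφ : IsWeight Cφ φ),
        ∃ (I : Ω → dampedDomain hΩ.rectifiablyConnected hφ)
          (infty : dampedDomain hΩ.rectifiablyConnected hφ),
          (∀ x, (I x : DampedCompletion hΩ.rectifiablyConnected hφ)
            = toDamped hΩ.rectifiablyConnected hφ x) ∧
          range I = {infty}ᶜ ∧
          IsEmbedding I ∧
          BoundedSpace (dampedDomain hΩ.rectifiablyConnected hφ) ∧
          IsUniformDomain (A Cφ CU) (dampedDomain hΩ.rectifiablyConnected hφ) ∧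
          (∃ e : boundary Ω ≃ₜ boundary (dampedDomain hΩ.rectifiablyConnected hφ),
            ∀ (ζ : boundary Ω) (u : ℕ → Ω),
              Tendsto (fun n => (u n : UniformSpace.Completion Ω)) atTop (𝓝 ζ) ↔
                Tendsto (fun n => (I (u n) : UniformSpace.Completion
                  (dampedDomain hΩ.rectifiablyConnected hφ))) atTop (𝓝 (e ζ))) ∧
          LocallyBiLipschitz I ∧
          UniformlyLocallyBiLipschitzNearBoundary I ∧
          (IsLengthSpace Ω → LocallyIsometricNearBoundary I) := by
  refine ⟨dampedConstant, fun Ω _ _ CU Cφ φ hΩ hub hφ =>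
    ⟨hΩ.toDomain hφ, hΩ.infty hφ hub, fun _ => rfl, hΩ.range_toDomain hφ hub,
      hΩ.isEmbedding_toDomain hφ, ?_, hΩ.isUniformDomain_dampedDomain hφ hub, ?_,
      hΩ.locallyBiLipschitz_toDomain hφ, hΩ.uniformlyLocallyBiLipschitzNearBoundary_toDomain hφ,
      hΩ.locallyIsometricNearBoundary_toDomain hφ⟩⟩
  · have := hΩ.boundedSpace_completion hφ
    infer_instance
  · obtain ⟨e, he⟩ := hΩ.exists_boundary_homeomorph hφ
    exact ⟨e, hΩ.tendsto_boundary_iff hφ e he⟩
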